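/- **Setting.** Fix a finite set of potential covariates and real constants $c_S>0$, one for each subset $S$ of covariates. For every sample size $n$ let $X^{(n)}$ be the real design matrix with $n$ rows and one column per potential covariate, and let $y^{(n)}\in\mathbb R^n$ be the response vector. A model $M_\ell$ is a set of $d_\ell$ covariates; $X_\ell$ is the corresponding $n\times d_\ell$ submatrix, and under $M_\ell$ one has $Y\sim N_n(X_\ell\beta_\ell,\sigma_\ell^2 I_n)$, with likelihood $f_\ell(y\mid\beta_\ell,\sigma_\ell^2)$. Let $M_0$ be a fixed reference model (for example, the intercept-only model). Write $RSS_\ell=y^T[I_n-X_\ell(X_\ell^TX_\ell)^{-1}X_\ell^T]y$ and $BIC_\ell=-2\log\sup_{\beta_\ell,\sigma_\ell^2>0}f_\ell(y\mid\beta_\ell,\sigma_\ell^2)+(d_\ell+1)\log n$. The J-PEP prior of $M_\ell$, with training sample size $n^*=n$, imaginary design $X^*=X$ and power parameter $\delta=n$, is built from the independence Jeffreys baseline $\pi_\ell^N(\beta_\ell,\sigma_\ell^2)=c_\ell/\sigma_\ell^2$. Let $f_\ell(y^*\mid\beta_\ell,\sigma_\ell^2,\delta)$ be the likelihood raised to the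 power $1/\delta$ and normalized to be a density in $y^*\in\mathbb R^n$, and let $m_\ell^N(y^*\mid\delta)=\iint f_\ell(y^*\mid\beta_\ell,\sigma_\ell^2,\delta)\,\pi_\ell^N(\beta_\ell,\sigma_\ell^2)\,d\beta_\ell\,d\sigma_\ell^2$. Then $$\pi_\ell^{J\text{-}PEP}(\beta_\ell,\sigma_\ell^2)=\int \frac{f_\ell(y^*\mid\beta_\ell,\sigma_\ell^2,\delta)\,\pi_\ell^N(\beta_\ell,\sigma_\ell^2)}{m_\ell^N(y^*\mid\delta)}\,m_0^N(y^*\mid\delta)\,dy^* .$$ The marginal likelihood is $m_\ell^{J\text{-}PEP}(y)=\iint f_\ell(y\mid\beta_\ell,\sigma_\ell^2)\,\pi_\ell^{J\text{-}PEP}(\beta_\ell,\sigma_\ell^2)\,d\beta_\ell\,d\sigma_\ell^2$, and the Bayes factor is $BF_{\ell k}^{J\text{-}PEP}=m_\ell^{J\text{-}PEP}(y)/m_k^{J\text{-}PEP}(y)$. **Theorem.** Let $M_\ell$ and $M_k$ be two models, each strictly containing $M_0$. Suppose that for all large $n$ the matrices $X_\ell$ and $X_k$ have full column rank, and that there is an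 $\varepsilon>0$ such that $RSS_\ell/RSS_0\ge\varepsilon$ and $RSS_k/RSS_0\ge\varepsilon$ for all large $n$ (in particular $RSS_0>0$). Then for all large $n$ both marginal likelihoods are positive and finite, and $$-2\log BF_{\ell k}^{J\text{-}PEP}=n\log\frac{RSS_\ell}{RSS_k}+(d_\ell-d_k)\log n+O(1)\qquad(n\to\infty),$$ $$n\log\frac{RSS_\ell}{RSS_k}+(d_\ell-d_k)\log n=BIC_\ell-BIC_k\qquad\text{for all large }n.$$ Consequently, if $|BIC_\ell-BIC_k|\to\infty$, then $-2\log BF_{\ell k}^{J\text{-}PEP}\sim BIC_\ell-BIC_k$, in the sense that their ratio tends to $1$. -/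

import Mathlib

open MeasureTheory Filter Asymptotics
open scoped ENNReal Topology Matrix

namespace JPEP

/-- Density at `y` of the `m`-dimensional Normal distribution `N_m(μ, v I_m)`
(with respect to Lebesgue measure on `Fin m → ℝ`), for `v > 0`. -/
noncomputable def normalDensity {m : ℕ} (μ : Fin m → ℝ) (v : ℝ) (y : Fin m → ℝ) : ℝ :=
  (2 * Real.pi * v) ^ (-(m : ℝ) / 2) * Real.exp (-(∑ i, (y i - μ i) ^ 2) / (2 * v))

/-- Likelihood `f(y | β, σ²; X)` of the Gaussian linear model `Y ~ N_m(X β, σ² I_m)`, `v = σ²`. -/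
noncomputable def likelihood {m : ℕ} {κ : Type*} [Fintype κ] (X : Matrix (Fin m) κ ℝ)
    (β : κ → ℝ) (v : ℝ) (y : Fin m → ℝ) : ℝ≥0∞ :=
  ENNReal.ofReal (normalDensity (X *ᵥ β) v y)

/-- Power likelihood `f(y* | β, σ²; X*, δ)`: the likelihood raised to the power `1/δ`
and density-normalized. -/
noncomputable def powerLikelihood {m : ℕ} {κ : Type*} [Fintype κ] (δ : ℝ)
    (X : Matrix (Fin m) κ ℝ) (β : κ → ℝ) (v : ℝ) (y : Fin m → ℝ) : ℝ≥0∞ :=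
  likelihood X β v y ^ (1 / δ) / ∫⁻ z : Fin m → ℝ, likelihood X β v z ^ (1 / δ)

/-- Prior predictive `m^N(y* | X*, δ)` of the power likelihood under a (possibly improper)
prior density `prior β σ²` on `ℝ^κ × (0, ∞)`. -/
noncomputable def priorPredictive {m : ℕ} {κ : Type*} [Fintype κ] (δ : ℝ)
    (X : Matrix (Fin m) κ ℝ) (prior : (κ → ℝ) → ℝ → ℝ≥0∞) (y : Fin m → ℝ) : ℝ≥0∞ :=
  ∫⁻ β : κ → ℝ, ∫⁻ v in Set.Ioi (0 : ℝ), powerLikelihood δ X β v y * prior β v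

/-- Posterior density `π^N(β, σ² | y*, δ)` given imaginary data `y*`, under the power likelihood
and the baseline prior. -/
noncomputable def imaginaryPosterior {m : ℕ} {κ : Type*} [Fintype κ] (δ : ℝ)
    (X : Matrix (Fin m) κ ℝ) (prior : (κ → ℝ) → ℝ → ℝ≥0∞) (y : Fin m → ℝ)
    (β : κ → ℝ) (v : ℝ) : ℝ≥0∞ :=
  powerLikelihood δ X β v y * prior β v / priorPredictive δ X prior y

/-- Power-expected-posterior (PEP) prior density of a model with imaginary design `X` and
baseline prior `prior`; the reference model has imaginary design `X₀` and baseline `prior₀`. -/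
noncomputable def pepPrior {m : ℕ} {κ κ₀ : Type*} [Fintype κ] [Fintype κ₀] (δ : ℝ)
    (X₀ : Matrix (Fin m) κ₀ ℝ) (prior₀ : (κ₀ → ℝ) → ℝ → ℝ≥0∞)
    (X : Matrix (Fin m) κ ℝ) (prior : (κ → ℝ) → ℝ → ℝ≥0∞)
    (β : κ → ℝ) (v : ℝ) : ℝ≥0∞ :=
  ∫⁻ ystar : Fin m → ℝ,
    imaginaryPosterior δ X prior ystar β v * priorPredictive δ X₀ prior₀ ystar

/-- Marginal likelihood of the data `y` with design `X` under a prior density for `(β, σ²)`. -/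
noncomputable def marginalLikelihood {n : ℕ} {κ : Type*} [Fintype κ]
    (X : Matrix (Fin n) κ ℝ) (prior : (κ → ℝ) → ℝ → ℝ≥0∞) (y : Fin n → ℝ) : ℝ≥0∞ :=
  ∫⁻ β : κ → ℝ, ∫⁻ v in Set.Ioi (0 : ℝ), likelihood X β v y * prior β v

/-- The independence Jeffreys prior `c / σ²`. -/
noncomputable def jeffreys {κ : Type*} (c : ℝ) (_β : κ → ℝ) (v : ℝ) : ℝ≥0∞ :=
  ENNReal.ofReal (c / v)

/-- Design matrix of the model whose covariates are the columns in `S`. -/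
def design {n : ℕ} {ι : Type*} (X : Matrix (Fin n) ι ℝ) (S : Finset ι) :
    Matrix (Fin n) S ℝ :=
  X.submatrix id (fun j : S => (j : ι))

/-- Marginal likelihood of model `S` under its J-PEP prior, with reference model `S₀`,
training sample size `n* = n`, imaginary design `X* = X` and power parameter `δ = n`;
`c S` is the arbitrary constant of the Jeffreys prior of model `S`. -/
noncomputable def jpepMarginal {n : ℕ} {ι : Type*} (X : Matrix (Fin n) ι ℝ) (y : Fin n → ℝ)
    (c : Finset ι → ℝ) (S₀ S : Finset ι) : ℝ≥0∞ :=
  marginalLikelihood (design X S)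
    (pepPrior (n : ℝ) (design X S₀) (jeffreys (c S₀)) (design X S) (jeffreys (c S))) y

/-- J-PEP Bayes factor of model `S` against model `T` (reference model `S₀`). -/
noncomputable def jpepBF {n : ℕ} {ι : Type*} (X : Matrix (Fin n) ι ℝ) (y : Fin n → ℝ)
    (c : Finset ι → ℝ) (S₀ S T : Finset ι) : ℝ :=
  (jpepMarginal X y c S₀ S / jpepMarginal X y c S₀ T).toReal

/-- Residual sum of squares `yᵀ (I - X (Xᵀ X)⁻¹ Xᵀ) y` of model `S`. -/
noncomputable def rss {n : ℕ} {ι : Type*} [DecidableEq ι] (X : Matrix (Fin n) ι ℝ)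
    (y : Fin n → ℝ) (S : Finset ι) : ℝ :=
  y ⬝ᵥ ((1 - design X S * ((design X S)ᵀ * design X S)⁻¹ * (design X S)ᵀ) *ᵥ y)

/-- Schwarz's criterion: minus twice the maximized log-likelihood plus `log n` times the number
of free parameters (`#S` regression coefficients and the error variance). -/
noncomputable def bic {n : ℕ} {ι : Type*} (X : Matrix (Fin n) ι ℝ) (y : Fin n → ℝ)
    (S : Finset ι) : ℝ :=
  -2 * Real.log (sSup {L : ℝ | ∃ (β : S → ℝ) (v : ℝ), 0 < v ∧
      L = normalDensity (design X S *ᵥ β) v y})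
    + ((S.card : ℝ) + 1) * Real.log n

end JPEP

namespace JPEP

/-! Write `d₀`, `d` for the dimensions of the reference model and of a larger model, with design
`X`. By Tonelli the marginal likelihood is an integral over imaginary data `y*` of the ratio of the
two prior predictives times a joint term, the integral over `(β, σ²)` of likelihood, power
likelihood and Jeffreys prior. All of these are explicit. The power likelihood is normal with
variance `δσ²`; a predictive is a constant times `RSS(y*)` to the power `-(n - d)/2`
(`priorPredictive_jeffreys`). Completing the square makes the joint term a constant times `Q ^ (-(n
- d/2))`, where `Q = RSS(y) + RSS(y*)/δ + |P(y - y*)|²/(1 + δ)` and `P` projects onto the column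
space (`lintegral_likelihood_mul_powerLikelihood`). The model's Jeffreys constant and Gram
determinant cancel.

In orthonormal coordinates `y* = (z, w, u)`, with `u` along the reference column space and `(w, u)`
along the larger one, only `|z|²`, `|w|²` and distances to the coordinates `(z₀, w₀, u₀)` of `y`
remain (`AdaptedCoords.marginalLikelihood_eq`). The `u`-integral is an exact Student integral.
Dropping `|w - w₀|²` bounds the rest above by Student integrals (`imaginaryIntegral_le`); Jensen's
inequality in `w` bounds it below with the same main constant (`le_imaginaryIntegral`). The two
bounds differ by a bounded factor: `δ = n` offsets an exponent of order `n`, and `|w₀|²/|z₀|² =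
RSS₀/RSS - 1` is at most `1/ε`.

After cancellation of the Gamma factors (`marginalConst_mul_imaginaryConst`), the logarithm of the
marginal likelihood is a term common to all models, minus `(d/2) log (1 + n)`, minus `((n - d₀)/2)
log RSS`, up to `O(1)`. In a Bayes factor the common term cancels, and the leftover `d₀ log
(RSSₗ/RSSₖ)` is bounded because both residual sums lie in `[ε RSS₀, RSS₀]`. The BIC identity is the
usual maximization of the Gaussian likelihood. -/

/-- The sum of the squares of the coordinates. -/
def sumSq {κ : Type*} [Fintype κ] (w : κ → ℝ) : ℝ := ∑ i, w i ^ 2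

/-! ### Squared Euclidean norms on coordinate spaces -/

section SumSq

variable {κ : Type*} [Fintype κ]

lemma sumSq_nonneg (w : κ → ℝ) : 0 ≤ sumSq w :=
  Finset.sum_nonneg fun _ _ => sq_nonneg _

@[simp] lemma sumSq_zero : sumSq (0 : κ → ℝ) = 0 := by simp [sumSq]

lemma sumSq_eq_zero {w : κ → ℝ} : sumSq w = 0 ↔ w = 0 := by
  rw [sumSq, Finset.sum_eq_zero_iff_of_nonneg fun _ _ => sq_nonneg _]
  simp [funext_iff]

lemma sumSq_pos {w : κ → ℝ} (hw : w ≠ 0) : 0 < sumSq w :=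
  (sumSq_nonneg w).lt_of_ne fun h => hw (sumSq_eq_zero.1 h.symm)

lemma sumSq_smul (r : ℝ) (w : κ → ℝ) : sumSq (r • w) = r ^ 2 * sumSq w := by
  simp [sumSq, Finset.mul_sum, mul_pow]

lemma sumSq_eq_dotProduct (w : κ → ℝ) : sumSq w = w ⬝ᵥ w := by
  simp [sumSq, dotProduct, sq]

lemma sumSq_sub_comm (v w : κ → ℝ) : sumSq (v - w) = sumSq (w - v) := by
  simp only [sumSq, Pi.sub_apply, sub_sq_comm (v _)]

lemma sumSq_sub_le (v w : κ → ℝ) : sumSq (v - w) ≤ 2 * sumSq v + 2 * sumSq w := by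
  simp only [sumSq, Finset.mul_sum, ← Finset.sum_add_distrib, Pi.sub_apply]
  exact Finset.sum_le_sum fun i _ => by nlinarith [sq_nonneg (v i + w i)]

@[fun_prop] lemma measurable_sumSq : Measurable (sumSq : (κ → ℝ) → ℝ) := by
  unfold sumSq; fun_prop

end SumSq

/-! ### Gaussian, Gamma and Student integrals -/

section Integrals

variable {κ : Type*} [Fintype κ]

lemma lintegral_ofReal_of_integral_pos {α : Type*} [MeasurableSpace α] {μ : Measure α}
    {f : α → ℝ} (hf : 0 ≤ᵐ[μ] f) {a : ℝ} (ha : 0 < a) (h : ∫ x, f x ∂μ = a) :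
    ∫⁻ x, ENNReal.ofReal (f x) ∂μ = ENNReal.ofReal a := by
  rw [← h, ofReal_integral_eq_lintegral_ofReal _ hf]
  -- A non-integrable function has Bochner integral `0`, so a positive value already gives
  -- integrability.
  exact Integrable.of_integral_ne_zero (h ▸ ha.ne')

lemma lintegral_exp_neg_mul_sumSq {t : ℝ} (ht : 0 < t) :
    ∫⁻ w : κ → ℝ, ENNReal.ofReal (Real.exp (-(t * sumSq w)))
      = ENNReal.ofReal ((Real.pi / t) ^ ((Fintype.card κ : ℝ) / 2)) := by
  refine lintegral_ofReal_of_integral_pos (ae_of_all _ fun _ => (Real.exp_pos _).le)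
    (by positivity) ?_
  have h1 : ∀ w : κ → ℝ, Real.exp (-(t * sumSq w)) = ∏ i, Real.exp (-t * w i ^ 2) := fun w => by
    rw [← Real.exp_sum, sumSq, Finset.mul_sum, ← Finset.sum_neg_distrib]
    simp only [neg_mul]
  simp_rw [h1]
  rw [integral_fintype_prod_volume_eq_prod (f := fun _ : κ => fun x : ℝ => Real.exp (-t * x ^ 2))]
  rw [Finset.prod_const, integral_gaussian, Real.sqrt_eq_rpow, ← Real.rpow_natCast,
    ← Real.rpow_mul (by positivity), Finset.card_univ]
  congr 1
  ring

lemma lintegral_rpow_mul_exp_neg {a b : ℝ} (ha : 0 < a) (hb : 0 < b) :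
    ∫⁻ τ in Set.Ioi (0 : ℝ), ENNReal.ofReal (τ ^ (a - 1) * Real.exp (-(b * τ)))
      = ENNReal.ofReal (Real.Gamma a * b ^ (-a)) := by
  have hG := Real.Gamma_pos_of_pos ha
  refine lintegral_ofReal_of_integral_pos ?_ (by positivity) ?_
  · filter_upwards [ae_restrict_mem measurableSet_Ioi] with x hx
    have : (0 : ℝ) < x := hx
    simp only [Pi.zero_apply]; positivity
  · rw [Real.integral_rpow_mul_exp_neg_mul_Ioi ha hb, Real.rpow_neg hb.le, one_div,
      Real.inv_rpow hb.le, mul_comm]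

/-- The substitution `τ = v⁻¹` reduces this to the Gamma integral. -/
lemma lintegral_inv_gamma {a b : ℝ} (ha : 0 < a) (hb : 0 < b) :
    ∫⁻ v in Set.Ioi (0 : ℝ), ENNReal.ofReal (v ^ (-a - 1) * Real.exp (-(b / v)))
      = ENNReal.ofReal (Real.Gamma a * b ^ (-a)) := by
  have hG := Real.Gamma_pos_of_pos ha
  refine lintegral_ofReal_of_integral_pos ?_ (by positivity) ?_
  · filter_upwards [ae_restrict_mem measurableSet_Ioi] with x hx
    have : (0 : ℝ) < x := hx
    simp only [Pi.zero_apply]; positivity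
  · have h := integral_comp_rpow_Ioi
      (fun τ : ℝ => τ ^ (a - 1) * Real.exp (-(b * τ))) (p := -1) (by norm_num)
    rw [Real.integral_rpow_mul_exp_neg_mul_Ioi ha hb] at h
    rw [Real.rpow_neg hb.le, ← Real.inv_rpow hb.le, mul_comm (Real.Gamma a), ← one_div, ← h]
    refine setIntegral_congr_fun measurableSet_Ioi fun v hv => ?_
    have hv : (0 : ℝ) < v := hv
    simp only [smul_eq_mul, abs_neg, abs_one, one_mul]
    rw [← Real.rpow_mul hv.le, ← mul_assoc, ← Real.rpow_add hv, Real.rpow_neg_one, div_eq_mul_inv]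
    congr 2
    ring

/-- The normalization of the multivariate Student distribution. -/
lemma lintegral_add_mul_sumSq_rpow {s C lam : ℝ} (hs : (Fintype.card κ : ℝ) / 2 < s)
    (hC : 0 < C) (hlam : 0 < lam) :
    ∫⁻ w : κ → ℝ, ENNReal.ofReal ((C + lam * sumSq w) ^ (-s))
      = ENNReal.ofReal ((Real.pi / lam) ^ ((Fintype.card κ : ℝ) / 2)
          * (Real.Gamma (s - (Fintype.card κ : ℝ) / 2) / Real.Gamma s)
          * C ^ (-(s - (Fintype.card κ : ℝ) / 2))) := by
  set k : ℝ := (Fintype.card κ : ℝ) / 2 with hk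
  have hk0 : 0 ≤ k := by positivity
  have hs0 : 0 < s := hk0.trans_lt hs
  have hG := Real.Gamma_pos_of_pos hs0
  have hG' := Real.Gamma_pos_of_pos (sub_pos.2 hs)
  -- `Γ(s)` times the power is a Gamma integral over a mixing variable `τ`. After Tonelli the
  -- `w`-integral is Gaussian, and it lowers the shape from `s` to `s - k`.
  have key : ENNReal.ofReal (Real.Gamma s) * ∫⁻ w : κ → ℝ,
      ENNReal.ofReal ((C + lam * sumSq w) ^ (-s))
      = ENNReal.ofReal ((Real.pi / lam) ^ k * (Real.Gamma (s - k) * C ^ (-(s - k)))) := by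
    rw [← lintegral_const_mul _ (by fun_prop)]
    have h1 : ∀ w : κ → ℝ, ENNReal.ofReal (Real.Gamma s)
        * ENNReal.ofReal ((C + lam * sumSq w) ^ (-s))
        = ∫⁻ τ in Set.Ioi (0 : ℝ),
          ENNReal.ofReal (τ ^ (s - 1) * Real.exp (-((C + lam * sumSq w) * τ))) := fun w => by
      have := sumSq_nonneg w
      rw [lintegral_rpow_mul_exp_neg hs0 (by positivity), ENNReal.ofReal_mul hG.le]
    simp_rw [h1]
    rw [lintegral_lintegral_swap (by fun_prop)]
    have h2 : ∀ τ ∈ Set.Ioi (0 : ℝ), ∫⁻ w : κ → ℝ,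
        ENNReal.ofReal (τ ^ (s - 1) * Real.exp (-((C + lam * sumSq w) * τ)))
        = ENNReal.ofReal ((Real.pi / lam) ^ k) *
          ENNReal.ofReal (τ ^ (s - k - 1) * Real.exp (-(C * τ))) := fun τ hτ => by
      have hτ : (0 : ℝ) < τ := hτ
      have h3 : ∀ w : κ → ℝ,
          ENNReal.ofReal (τ ^ (s - 1) * Real.exp (-((C + lam * sumSq w) * τ)))
          = ENNReal.ofReal (τ ^ (s - 1) * Real.exp (-(C * τ))) *
            ENNReal.ofReal (Real.exp (-((lam * τ) * sumSq w))) := fun w => by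
        rw [← ENNReal.ofReal_mul (by positivity), mul_assoc, ← Real.exp_add]
        ring_nf
      simp_rw [h3]
      rw [lintegral_const_mul _ (by fun_prop), lintegral_exp_neg_mul_sumSq (by positivity), ← hk,
        ← ENNReal.ofReal_mul (by positivity), ← ENNReal.ofReal_mul (by positivity)]
      congr 1
      rw [← div_div, Real.div_rpow (by positivity) hτ.le, show s - k - 1 = s - 1 - k by ring,
        Real.rpow_sub hτ (s - 1) k]
      ring
    rw [setLIntegral_congr_fun measurableSet_Ioi h2, lintegral_const_mul _ (by fun_prop),
      lintegral_rpow_mul_exp_neg (sub_pos.2 hs) hC, ← ENNReal.ofReal_mul (by positivity)]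
  have h4 : (Real.pi / lam) ^ k * (Real.Gamma (s - k) * C ^ (-(s - k)))
      = Real.Gamma s * ((Real.pi / lam) ^ k * (Real.Gamma (s - k) / Real.Gamma s)
          * C ^ (-(s - k))) := by
    field_simp
  rw [h4, ENNReal.ofReal_mul hG.le] at key
  exact (ENNReal.mul_right_inj (by simpa using hG) ENNReal.ofReal_ne_top).1 key

lemma lintegral_comp_smul_pi (f : (κ → ℝ) → ℝ≥0∞) {r : ℝ} (hr : 0 < r) :
    ∫⁻ w : κ → ℝ, f (r • w) = ENNReal.ofReal (r ^ (-(Fintype.card κ : ℝ))) * ∫⁻ w, f w := by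
  have h := Measure.map_addHaar_smul (volume : Measure (κ → ℝ)) hr.ne'
  have h2 : ∫⁻ w : κ → ℝ, f (r • w) = ∫⁻ w, f w ∂(Measure.map (r • ·) volume) :=
    (lintegral_map_equiv f (MeasurableEquiv.smul₀ r hr.ne')).symm
  rw [h2, h, lintegral_smul_measure, Module.finrank_fintype_fun_eq_card, smul_eq_mul]
  congr 2
  rw [abs_of_pos (by positivity), Real.rpow_neg hr.le, Real.rpow_natCast]

/-- The integral `∫ exp (-|X β|²) dβ`, a multiple of `det (Xᵀ X) ^ (-1/2)`. -/
noncomputable def gramIntegral {m : ℕ} (X : Matrix (Fin m) κ ℝ) : ℝ≥0∞ :=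
  ∫⁻ β : κ → ℝ, ENNReal.ofReal (Real.exp (-sumSq (X *ᵥ β)))

@[fun_prop] lemma measurable_mulVec {m : ℕ} (X : Matrix (Fin m) κ ℝ) :
    Measurable fun β : κ → ℝ => X *ᵥ β := by
  unfold Matrix.mulVec dotProduct; fun_prop

lemma gramIntegral_pos {m : ℕ} (X : Matrix (Fin m) κ ℝ) : 0 < gramIntegral X := by
  rw [gramIntegral, lintegral_pos_iff_support (by fun_prop)]
  have : (Function.support fun β : κ → ℝ => ENNReal.ofReal (Real.exp (-sumSq (X *ᵥ β))))
      = Set.univ := by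
    ext β; simp [Real.exp_pos]
  rw [this]
  exact isOpen_univ.measure_pos _ Set.univ_nonempty

/-- An injective linear map in finite dimension is bounded below, so the integrand is dominated by a
Gaussian in `β`. -/
lemma gramIntegral_lt_top {m : ℕ} {X : Matrix (Fin m) κ ℝ} (hX : LinearIndependent ℝ X.col) :
    gramIntegral X < ⊤ := by
  have hker : LinearMap.ker X.mulVecLin = ⊥ :=
    LinearMap.ker_eq_bot.2 (Matrix.mulVec_injective_iff.2 hX)
  obtain ⟨K, hK, hK'⟩ := X.mulVecLin.exists_antilipschitzWith hker
  have hK0 : (0 : ℝ) < K := by exact_mod_cast hK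
  -- The cardinality pays for passing from the sup norm to the sum of squares; the `+ 1` keeps `L`
  -- positive when `κ` is empty.
  set L : ℝ := (K : ℝ) ^ 2 * ((Fintype.card κ : ℝ) + 1) with hL
  have hL0 : 0 < L := by positivity
  have hle : ∀ β : κ → ℝ, sumSq β ≤ L * sumSq (X *ᵥ β) := fun β => by
    have h1 : ‖β‖ ≤ K * ‖X *ᵥ β‖ := by
      have := hK'.le_mul_dist β 0
      simpa using this
    have h2 : ‖X *ᵥ β‖ ^ 2 ≤ sumSq (X *ᵥ β) := by
      have : ‖X *ᵥ β‖ ≤ √(sumSq (X *ᵥ β)) := by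
        refine (pi_norm_le_iff_of_nonneg (Real.sqrt_nonneg _)).2 fun i => ?_
        refine Real.le_sqrt_of_sq_le ?_
        rw [Real.norm_eq_abs, sq_abs]
        exact Finset.single_le_sum (f := fun i => (X *ᵥ β) i ^ 2) (fun _ _ => sq_nonneg _)
          (Finset.mem_univ i)
      calc ‖X *ᵥ β‖ ^ 2 ≤ √(sumSq (X *ᵥ β)) ^ 2 := by gcongr
        _ = _ := Real.sq_sqrt (sumSq_nonneg _)
    have h3 : sumSq β ≤ Fintype.card κ * ‖β‖ ^ 2 := by
      rw [sumSq]
      refine (Finset.sum_le_card_nsmul _ _ (‖β‖ ^ 2) fun i _ => ?_).trans (by simp)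
      rw [← sq_abs, ← Real.norm_eq_abs]
      gcongr
      exact norm_le_pi_norm β i
    have h4 : ‖β‖ ^ 2 ≤ K ^ 2 * sumSq (X *ᵥ β) := by
      calc ‖β‖ ^ 2 ≤ (K * ‖X *ᵥ β‖) ^ 2 := by gcongr
        _ = K ^ 2 * ‖X *ᵥ β‖ ^ 2 := by ring
        _ ≤ _ := by gcongr
    have h5 : 0 ≤ (K : ℝ) ^ 2 * sumSq (X *ᵥ β) := mul_nonneg (by positivity) (sumSq_nonneg _)
    calc sumSq β ≤ Fintype.card κ * (K ^ 2 * sumSq (X *ᵥ β)) := h3.trans (by gcongr)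
      _ ≤ L * sumSq (X *ᵥ β) := by rw [hL]; nlinarith
  calc gramIntegral X
      ≤ ∫⁻ β : κ → ℝ, ENNReal.ofReal (Real.exp (-(L⁻¹ * sumSq β))) := by
        refine lintegral_mono fun β => ENNReal.ofReal_le_ofReal (Real.exp_le_exp.2 ?_)
        rw [neg_le_neg_iff, inv_mul_le_iff₀ hL0]
        exact hle β
    _ < ⊤ := by
        rw [lintegral_exp_neg_mul_sumSq (by positivity)]
        exact ENNReal.ofReal_lt_top

lemma lintegral_exp_neg_mul_sumSq_mulVec {m : ℕ} (X : Matrix (Fin m) κ ℝ) (β₀ : κ → ℝ) {t : ℝ}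
    (ht : 0 < t) :
    ∫⁻ β : κ → ℝ, ENNReal.ofReal (Real.exp (-(t * sumSq (X *ᵥ (β - β₀)))))
      = ENNReal.ofReal (t ^ (-((Fintype.card κ : ℝ) / 2))) * gramIntegral X := by
  rw [lintegral_sub_right_eq_self
    (fun β : κ → ℝ => ENNReal.ofReal (Real.exp (-(t * sumSq (X *ᵥ β))))) β₀]
  have h := lintegral_comp_smul_pi
    (fun β : κ → ℝ => ENNReal.ofReal (Real.exp (-sumSq (X *ᵥ β)))) (Real.sqrt_pos.2 ht)
  simp only [Matrix.mulVec_smul, sumSq_smul, Real.sq_sqrt ht.le] at h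
  rw [h, gramIntegral, Real.sqrt_eq_rpow, ← Real.rpow_mul ht.le]
  congr 3
  ring

end Integrals

/-- The tangent line at `1` of the convex function `x ↦ x ^ (-s)`: all that Jensen's inequality
needs below. -/
lemma one_sub_mul_le_rpow_neg {x s : ℝ} (hx : 0 < x) (hs : 0 ≤ s) :
    1 - s * (x - 1) ≤ x ^ (-s) := by
  rw [Real.rpow_def_of_pos hx]
  have h1 := Real.add_one_le_exp (Real.log x * -s)
  have h2 := mul_le_mul_of_nonneg_left (Real.log_le_sub_one_of_pos hx) hs
  linarith

/-- The normalizing constant of `lintegral_add_mul_sumSq_rpow`. -/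
noncomputable def studentConst (k lam s : ℝ) : ℝ :=
  (Real.pi / lam) ^ (k / 2) * (Real.Gamma (s - k / 2) / Real.Gamma s)

lemma studentConst_pos {k lam s : ℝ} (hk : 0 ≤ k) (hlam : 0 < lam) (hs : k / 2 < s) :
    0 < studentConst k lam s := by
  have := Real.Gamma_pos_of_pos (sub_pos.2 hs)
  have := Real.Gamma_pos_of_pos (show 0 < s by linarith)
  unfold studentConst
  positivity

lemma lintegral_student {κ : Type*} [Fintype κ] {s C lam : ℝ}
    (hs : (Fintype.card κ : ℝ) / 2 < s) (hC : 0 < C) (hlam : 0 < lam) :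
    ∫⁻ w : κ → ℝ, ENNReal.ofReal ((C + lam * sumSq w) ^ (-s))
      = ENNReal.ofReal (studentConst (Fintype.card κ) lam s
          * C ^ (-(s - (Fintype.card κ : ℝ) / 2))) :=
  lintegral_add_mul_sumSq_rpow hs hC hlam

lemma lintegral_student_sub {κ : Type*} [Fintype κ] {s C lam : ℝ}
    (hs : (Fintype.card κ : ℝ) / 2 < s) (hC : 0 < C) (hlam : 0 < lam) (w₀ : κ → ℝ) :
    ∫⁻ w : κ → ℝ, ENNReal.ofReal ((C + lam * sumSq (w - w₀)) ^ (-s))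
      = ENNReal.ofReal (studentConst (Fintype.card κ) lam s
          * C ^ (-(s - (Fintype.card κ : ℝ) / 2))) := by
  rw [← lintegral_student hs hC hlam]
  exact lintegral_sub_right_eq_self
    (fun w : κ → ℝ => ENNReal.ofReal ((C + lam * sumSq w) ^ (-s))) w₀

lemma lintegral_student_one {κ : Type*} [Fintype κ] {N ρ : ℝ} (hN : 0 < N) (hρ : 0 < ρ) :
    ∫⁻ w : κ → ℝ, ENNReal.ofReal ((ρ + sumSq w) ^ (-((N + Fintype.card κ) / 2)))
      = ENNReal.ofReal (studentConst (Fintype.card κ) 1 ((N + Fintype.card κ) / 2)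
          * ρ ^ (-(N / 2))) := by
  have h := lintegral_student (κ := κ) (s := (N + Fintype.card κ) / 2) (C := ρ) (lam := 1)
    (by linarith) hρ one_pos
  simp only [one_mul] at h
  rw [h]
  congr 3
  ring

/-- Jensen's inequality for `x ↦ x ^ (-s)` under a multivariate Student distribution, whose second
moment is `ρ q / (N - 2)`. -/
lemma le_lintegral_student_mul_rpow {κ : Type*} [Fintype κ] {N ρ P lam s : ℝ} (hN : 2 < N)
    (hρ : 0 < ρ) (hP : 0 < P) (hlam : 0 < lam) (hs : 0 ≤ s) :
    ENNReal.ofReal (studentConst (Fintype.card κ) 1 ((N + Fintype.card κ) / 2) * ρ ^ (-(N / 2))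
        * (P + lam * (ρ * Fintype.card κ / (N - 2))) ^ (-s))
      ≤ ∫⁻ w : κ → ℝ, ENNReal.ofReal ((ρ + sumSq w) ^ (-((N + Fintype.card κ) / 2))
          * (P + lam * sumSq w) ^ (-s)) := by
  set q : ℝ := (Fintype.card κ : ℝ) with hq
  have hq0 : 0 ≤ q := by positivity
  set r : ℝ := ρ * q / (N - 2) with hr
  have hN2 : 0 < N - 2 := by linarith
  have hr0 : 0 ≤ r := by positivity
  set t : ℝ := P + lam * r with ht
  have ht0 : 0 < t := by positivity
  set c : ℝ := studentConst q 1 ((N + q) / 2) with hc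
  have hc0 : 0 < c := studentConst_pos hq0 one_pos (by linarith)
  have hmass := lintegral_student_one (κ := κ) (N := N) (by linarith) hρ
  rw [← hq, ← hc] at hmass
  -- The extra factor turns the weight into the one with `N - 2` in place of `N`, so the second
  -- moment comes from the mass formula; this is where `2 < N` enters.
  have hmean : ∫⁻ w : κ → ℝ, ENNReal.ofReal ((ρ + sumSq w) ^ (-((N + q) / 2)) * (ρ + sumSq w))
      = ENNReal.ofReal (c * ρ ^ (-(N / 2)) * (ρ + r)) := by
    have h1 : ∀ w : κ → ℝ, (ρ + sumSq w) ^ (-((N + q) / 2)) * (ρ + sumSq w)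
        = (ρ + sumSq w) ^ (-((N - 2 + q) / 2)) := fun w => by
      have : 0 < ρ + sumSq w := by have := sumSq_nonneg w; positivity
      nth_rewrite 2 [← Real.rpow_one (ρ + sumSq w)]
      rw [← Real.rpow_add this]
      congr 1
      ring
    simp_rw [h1]
    rw [lintegral_student_one hN2 hρ]
    congr 1
    have hg1 : Real.Gamma (N / 2) = (N / 2 - 1) * Real.Gamma (N / 2 - 1) := by
      rw [← Real.Gamma_add_one (by linarith)]; congr 1; ring
    have hg2 : Real.Gamma ((N + q) / 2) = ((N - 2 + q) / 2) * Real.Gamma ((N - 2 + q) / 2) := by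
      rw [← Real.Gamma_add_one (by linarith)]; congr 1; ring
    have hp1 := Real.Gamma_pos_of_pos (show 0 < N / 2 - 1 by linarith)
    have hp2 := Real.Gamma_pos_of_pos (show 0 < (N - 2 + q) / 2 by linarith)
    have e1 : (N - 2 + q) / 2 - q / 2 = N / 2 - 1 := by ring
    have e2 : (N + q) / 2 - q / 2 = N / 2 := by ring
    have e3 : ρ ^ (-((N - 2) / 2)) = ρ ^ (-(N / 2)) * ρ := by
      nth_rewrite 3 [← Real.rpow_one ρ]
      rw [← Real.rpow_add hρ]; congr 1; ring
    rw [hc, studentConst, studentConst, ← hq, e1, e2, e3, hg1, hg2, hr]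
    have : 0 < N - 2 + q := by linarith
    field_simp
  -- The tangent line at the mean `t` of `P + lam * sumSq w`, with its negative part moved to the
  -- right so that both sides can be integrated in `ℝ≥0∞`.
  have hle : ∀ w : κ → ℝ,
      (t ^ (-s) * (1 + s * (lam * (ρ + r) / t))) * (ρ + sumSq w) ^ (-((N + q) / 2))
      ≤ (ρ + sumSq w) ^ (-((N + q) / 2)) * (P + lam * sumSq w) ^ (-s)
        + (t ^ (-s) * s * lam / t) * ((ρ + sumSq w) ^ (-((N + q) / 2)) * (ρ + sumSq w)) :=
    fun w => by
      have hw := sumSq_nonneg w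
      have hx : 0 < P + lam * sumSq w := by positivity
      have h1 := one_sub_mul_le_rpow_neg (div_pos hx ht0) hs
      rw [Real.div_rpow hx.le ht0.le, le_div_iff₀ (by positivity)] at h1
      have hF : 0 < (ρ + sumSq w) ^ (-((N + q) / 2)) := by positivity
      have h2 := mul_le_mul_of_nonneg_left h1 hF.le
      have h3 : (1 - s * ((P + lam * sumSq w) / t - 1)) * t ^ (-s)
          = t ^ (-s) * (1 + s * (lam * (ρ + r) / t))
            - (t ^ (-s) * s * lam / t) * (ρ + sumSq w) := by
        rw [ht]; rw [ht] at ht0; field_simp; ring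
      rw [h3] at h2
      linarith
  have hint : ∫⁻ w : κ → ℝ, ENNReal.ofReal
      ((t ^ (-s) * (1 + s * (lam * (ρ + r) / t))) * (ρ + sumSq w) ^ (-((N + q) / 2)))
      ≤ ∫⁻ w : κ → ℝ, ENNReal.ofReal
        ((ρ + sumSq w) ^ (-((N + q) / 2)) * (P + lam * sumSq w) ^ (-s)
        + (t ^ (-s) * s * lam / t) * ((ρ + sumSq w) ^ (-((N + q) / 2)) * (ρ + sumSq w))) :=
    lintegral_mono fun w => ENNReal.ofReal_le_ofReal (hle w)
  have hsplit : ∀ w : κ → ℝ, ENNReal.ofReal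
      ((ρ + sumSq w) ^ (-((N + q) / 2)) * (P + lam * sumSq w) ^ (-s)
        + (t ^ (-s) * s * lam / t) * ((ρ + sumSq w) ^ (-((N + q) / 2)) * (ρ + sumSq w)))
      = ENNReal.ofReal ((ρ + sumSq w) ^ (-((N + q) / 2)) * (P + lam * sumSq w) ^ (-s))
        + ENNReal.ofReal (t ^ (-s) * s * lam / t)
          * ENNReal.ofReal ((ρ + sumSq w) ^ (-((N + q) / 2)) * (ρ + sumSq w)) := fun w => by
    have hw := sumSq_nonneg w
    rw [ENNReal.ofReal_add (by positivity) (by positivity),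
      ENNReal.ofReal_mul (p := t ^ (-s) * s * lam / t) (by positivity)]
  have hsplit' : ∀ w : κ → ℝ, ENNReal.ofReal
      ((t ^ (-s) * (1 + s * (lam * (ρ + r) / t))) * (ρ + sumSq w) ^ (-((N + q) / 2)))
      = ENNReal.ofReal (t ^ (-s) * (1 + s * (lam * (ρ + r) / t)))
        * ENNReal.ofReal ((ρ + sumSq w) ^ (-((N + q) / 2))) := fun w =>
    ENNReal.ofReal_mul (by positivity)
  simp_rw [hsplit, hsplit'] at hint
  rw [lintegral_const_mul _ (by fun_prop), lintegral_add_right _ (by fun_prop),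
    lintegral_const_mul _ (by fun_prop), hmass, hmean, ← ENNReal.ofReal_mul (by positivity),
    ← ENNReal.ofReal_mul (by positivity), ← tsub_le_iff_right,
    ← ENNReal.ofReal_sub _ (by positivity)] at hint
  refine le_trans (ENNReal.ofReal_le_ofReal (le_of_eq ?_)) hint
  field_simp
  ring

/-! ### Two-sided bounds for the integral over the imaginary data -/

section ProjectedIntegral

variable {κ₀ κ₁ κ₂ : Type*} [Fintype κ₀] [Fintype κ₁] [Fintype κ₂]

/-- The integral over the imaginary data, in coordinates adapted to two nested column spaces. -/
noncomputable def imaginaryIntegral (δ s A : ℝ) (w₀ : κ₁ → ℝ) (u₀ : κ₀ → ℝ) : ℝ≥0∞ :=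
  ∫⁻ z : κ₂ → ℝ, ∫⁻ w : κ₁ → ℝ, ∫⁻ u : κ₀ → ℝ,
    ENNReal.ofReal (sumSq z ^ ((Fintype.card κ₂ : ℝ) / 2)
      * (sumSq z + sumSq w) ^ (-(((Fintype.card κ₂ : ℝ) + Fintype.card κ₁) / 2))
      * (A + sumSq z / δ + (sumSq (w - w₀) + sumSq (u - u₀)) / (1 + δ)) ^ (-s))

/-- The variable `u` occurs only in the last factor, so its Student integral is exact, and
translation removes `u₀`. -/
lemma imaginaryIntegral_eq {δ s A : ℝ} (w₀ : κ₁ → ℝ) (u₀ : κ₀ → ℝ) (hδ : 0 < δ) (hA : 0 < A)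
    (hs : (Fintype.card κ₀ : ℝ) / 2 < s) :
    imaginaryIntegral (κ₂ := κ₂) δ s A w₀ u₀
      = ENNReal.ofReal (studentConst (Fintype.card κ₀) (1 + δ)⁻¹ s)
        * ∫⁻ z : κ₂ → ℝ, ENNReal.ofReal (sumSq z ^ ((Fintype.card κ₂ : ℝ) / 2))
          * ∫⁻ w : κ₁ → ℝ,
            ENNReal.ofReal ((sumSq z + sumSq w)
                ^ (-(((Fintype.card κ₂ : ℝ) + Fintype.card κ₁) / 2))
              * (A + sumSq z / δ + (1 + δ)⁻¹ * sumSq (w - w₀))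
                ^ (-(s - (Fintype.card κ₀ : ℝ) / 2))) := by
  have hδ' : 0 < 1 + δ := by positivity
  have hc := studentConst_pos (k := Fintype.card κ₀) (by positivity) (inv_pos.2 hδ') hs
  rw [imaginaryIntegral, ← lintegral_const_mul' _ _ ENNReal.ofReal_ne_top]
  refine lintegral_congr fun z => ?_
  have hz := sumSq_nonneg z
  rw [← lintegral_const_mul' _ _ ENNReal.ofReal_ne_top,
    ← lintegral_const_mul' _ _ ENNReal.ofReal_ne_top]
  refine lintegral_congr fun w => ?_
  have hw := sumSq_nonneg w
  have hw' := sumSq_nonneg (w - w₀)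
  have h1 : ∀ u : κ₀ → ℝ, ENNReal.ofReal (sumSq z ^ ((Fintype.card κ₂ : ℝ) / 2)
      * (sumSq z + sumSq w) ^ (-(((Fintype.card κ₂ : ℝ) + Fintype.card κ₁) / 2))
      * (A + sumSq z / δ + (sumSq (w - w₀) + sumSq (u - u₀)) / (1 + δ)) ^ (-s))
      = ENNReal.ofReal (sumSq z ^ ((Fintype.card κ₂ : ℝ) / 2)
      * (sumSq z + sumSq w) ^ (-(((Fintype.card κ₂ : ℝ) + Fintype.card κ₁) / 2)))
      * ENNReal.ofReal ((A + sumSq z / δ + (1 + δ)⁻¹ * sumSq (w - w₀)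
          + (1 + δ)⁻¹ * sumSq (u - u₀)) ^ (-s)) := fun u => by
    rw [← ENNReal.ofReal_mul (by positivity)]
    congr 3
    ring
  simp_rw [h1]
  rw [lintegral_const_mul' _ _ ENNReal.ofReal_ne_top,
    lintegral_student_sub hs (by positivity) (by positivity),
    ← ENNReal.ofReal_mul (by positivity), ← ENNReal.ofReal_mul (by positivity),
    ← ENNReal.ofReal_mul (by positivity)]
  congr 1
  ring

/-- The common factor in the upper and the lower bound of `imaginaryIntegral`. -/
noncomputable def imaginaryConst (k₀ q N δ s : ℝ) : ℝ :=
  studentConst k₀ (1 + δ)⁻¹ s * studentConst q 1 ((N + q) / 2)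
    * studentConst N δ⁻¹ (s - k₀ / 2)

/-- Dropping `sumSq (w - w₀)` decouples `w`. Its Student mass is a multiple of `sumSq z ^ (-N / 2)`,
which the prefactor cancels exactly; a Student integral in `z` remains. -/
lemma imaginaryIntegral_le {δ s A : ℝ} (w₀ : κ₁ → ℝ) (u₀ : κ₀ → ℝ) (hδ : 0 < δ) (hA : 0 < A)
    (hN : 0 < Fintype.card κ₂)
    (hs : (Fintype.card κ₂ : ℝ) / 2 < s - (Fintype.card κ₀ : ℝ) / 2) :
    imaginaryIntegral (κ₂ := κ₂) δ s A w₀ u₀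
      ≤ ENNReal.ofReal (imaginaryConst (Fintype.card κ₀) (Fintype.card κ₁) (Fintype.card κ₂) δ s
        * A ^ (-(s - (Fintype.card κ₀ : ℝ) / 2 - (Fintype.card κ₂ : ℝ) / 2))) := by
  have hδ' : 0 < 1 + δ := by positivity
  set k₀ : ℝ := (Fintype.card κ₀ : ℝ) with hk₀
  set q : ℝ := (Fintype.card κ₁ : ℝ) with hq
  set N : ℝ := (Fintype.card κ₂ : ℝ) with hN'
  have hN0 : 0 < N := by rw [hN']; exact_mod_cast hN
  have hk₀0 : 0 ≤ k₀ := by positivity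
  have hq0 : 0 ≤ q := by positivity
  have hc0 := studentConst_pos hk₀0 (inv_pos.2 hδ') (show k₀ / 2 < s by linarith)
  have hc1 := studentConst_pos hq0 one_pos (show q / 2 < (N + q) / 2 by linarith)
  rw [imaginaryIntegral_eq w₀ u₀ hδ hA (by linarith), imaginaryConst, mul_assoc, mul_assoc,
    ENNReal.ofReal_mul hc0.le, ENNReal.ofReal_mul hc1.le, ← lintegral_student hs hA (inv_pos.2 hδ)]
  gcongr
  rw [← lintegral_const_mul' _ _ ENNReal.ofReal_ne_top]
  refine lintegral_mono fun z => ?_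
  simp only
  -- At `z = 0` the Student mass formula fails, but the prefactor `0 ^ (N / 2)` vanishes.
  by_cases hz : z = 0
  · subst hz
    rw [sumSq_zero, Real.zero_rpow (by positivity)]
    simp
  have hz := sumSq_pos hz
  calc _ ≤ ENNReal.ofReal (sumSq z ^ (N / 2)) * ∫⁻ w : κ₁ → ℝ,
          ENNReal.ofReal ((sumSq z + sumSq w) ^ (-((N + q) / 2)))
            * ENNReal.ofReal ((A + δ⁻¹ * sumSq z) ^ (-(s - k₀ / 2))) := by
        gcongr with w
        have hw := sumSq_nonneg w
        have hw' := sumSq_nonneg (w - w₀)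
        rw [← ENNReal.ofReal_mul (by positivity)]
        refine ENNReal.ofReal_le_ofReal ?_
        gcongr ?_ * ?_
        refine Real.rpow_le_rpow_of_nonpos (by positivity) ?_ (by linarith)
        have : 0 ≤ (1 + δ)⁻¹ * sumSq (w - w₀) := by positivity
        rw [div_eq_inv_mul]
        linarith
    _ = _ := by
        rw [lintegral_mul_const' _ _ ENNReal.ofReal_ne_top, hq,
          lintegral_student_one hN0 hz, ← mul_assoc, ← ENNReal.ofReal_mul (by positivity)]
        congr 2
        rw [mul_left_comm, ← Real.rpow_add hz]
        simp

/-- By Jensen, `sumSq w` may be replaced by its mean `sumSq z * q / (N - 2)`. This only rescales the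
coefficient `δ⁻¹` of `sumSq z` by at most `D`, so the `z`-integral is again a Student integral. -/
lemma le_imaginaryIntegral {δ s A : ℝ} (w₀ : κ₁ → ℝ) (u₀ : κ₀ → ℝ) (hδ : 0 < δ) (hA : 0 < A)
    (hN : 2 < Fintype.card κ₂)
    (hs : (Fintype.card κ₂ : ℝ) / 2 < s - (Fintype.card κ₀ : ℝ) / 2) :
    ENNReal.ofReal (imaginaryConst (Fintype.card κ₀) (Fintype.card κ₁) (Fintype.card κ₂) δ s
        * (1 + 2 * (Fintype.card κ₁ : ℝ) / (Fintype.card κ₂ - 2))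
          ^ (-((Fintype.card κ₂ : ℝ) / 2))
        * (A + 2 * sumSq w₀ / (1 + δ))
          ^ (-(s - (Fintype.card κ₀ : ℝ) / 2 - (Fintype.card κ₂ : ℝ) / 2)))
      ≤ imaginaryIntegral (κ₂ := κ₂) δ s A w₀ u₀ := by
  have hδ' : 0 < 1 + δ := by positivity
  set k₀ : ℝ := (Fintype.card κ₀ : ℝ) with hk₀
  set q : ℝ := (Fintype.card κ₁ : ℝ) with hq
  set N : ℝ := (Fintype.card κ₂ : ℝ) with hN'
  have hN2 : 2 < N := by rw [hN']; exact_mod_cast hN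
  have hN0 : 0 < N - 2 := by linarith
  have hk₀0 : 0 ≤ k₀ := by positivity
  have hq0 : 0 ≤ q := by positivity
  have hw₀ := sumSq_nonneg w₀
  have hc0 := studentConst_pos hk₀0 (inv_pos.2 hδ') (show k₀ / 2 < s by linarith)
  have hc1 := studentConst_pos hq0 one_pos (show q / 2 < (N + q) / 2 by linarith)
  set D : ℝ := 1 + 2 * q / (N - 2) with hD
  have hD0 : 0 < D := by positivity
  set A' : ℝ := A + 2 * sumSq w₀ / (1 + δ) with hA'
  have hA'0 : 0 < A' := by positivity
  -- The loss `D ^ (-(N / 2))` is exactly the effect of the scale change `δ⁻¹ ↦ δ⁻¹ * D`.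
  have hscale : studentConst N δ⁻¹ (s - k₀ / 2) * D ^ (-(N / 2))
      = studentConst N (δ⁻¹ * D) (s - k₀ / 2) := by
    rw [studentConst, studentConst, ← div_div, Real.div_rpow (by positivity) hD0.le,
      Real.rpow_neg hD0.le]
    ring
  rw [imaginaryIntegral_eq w₀ u₀ hδ hA (by linarith), imaginaryConst, mul_assoc, mul_assoc,
    mul_assoc, ← mul_assoc _ (D ^ _), hscale, ENNReal.ofReal_mul hc0.le, ENNReal.ofReal_mul hc1.le,
    ← lintegral_student hs hA'0 (by positivity)]
  gcongr
  rw [← lintegral_const_mul' _ _ ENNReal.ofReal_ne_top]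
  refine lintegral_mono_ae ?_
  have : Nonempty κ₂ := Fintype.card_pos_iff.1 (by omega)
  filter_upwards [compl_mem_ae_iff.2 (measure_singleton (0 : κ₂ → ℝ))] with z hz
  have hz := sumSq_pos (by simpa using hz : z ≠ 0)
  have hJ := le_lintegral_student_mul_rpow (κ := κ₁) (N := N) (ρ := sumSq z)
    (P := A' + sumSq z / δ) (lam := 2 * (1 + δ)⁻¹) (s := s - k₀ / 2) hN2 hz (by positivity)
    (by positivity) (by linarith)
  calc _ ≤ ENNReal.ofReal (sumSq z ^ (N / 2)) * ENNReal.ofReal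
        (studentConst q 1 ((N + q) / 2) * sumSq z ^ (-(N / 2))
        * (A' + sumSq z / δ + 2 * (1 + δ)⁻¹ * (sumSq z * q / (N - 2))) ^ (-(s - k₀ / 2))) := by
        rw [← ENNReal.ofReal_mul hc1.le, ← ENNReal.ofReal_mul (by positivity)]
        refine ENNReal.ofReal_le_ofReal ?_
        have e : sumSq z ^ (N / 2) * (studentConst q 1 ((N + q) / 2) * sumSq z ^ (-(N / 2))
            * (A' + sumSq z / δ + 2 * (1 + δ)⁻¹ * (sumSq z * q / (N - 2))) ^ (-(s - k₀ / 2)))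
            = studentConst q 1 ((N + q) / 2) * (A' + sumSq z / δ
              + 2 * (1 + δ)⁻¹ * (sumSq z * q / (N - 2))) ^ (-(s - k₀ / 2)) := by
          rw [mul_comm (studentConst q 1 ((N + q) / 2)), mul_assoc, ← mul_assoc,
            ← Real.rpow_add hz]
          simp
        rw [e]
        gcongr ?_ * ?_
        refine Real.rpow_le_rpow_of_nonpos (by positivity) ?_ (by linarith)
        have h1 : (1 + δ)⁻¹ ≤ δ⁻¹ := inv_anti₀ hδ (by linarith)
        have h2 : 0 ≤ sumSq z * q / (N - 2) := by positivity
        have h3 := mul_le_mul_of_nonneg_right h1 h2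
        have e2 : A' + δ⁻¹ * D * sumSq z
            = A' + sumSq z / δ + 2 * (δ⁻¹ * (sumSq z * q / (N - 2))) := by
          rw [hD]; field_simp; ring
        rw [e2]
        linarith
    _ ≤ _ := by
        gcongr
        refine hJ.trans (lintegral_mono fun w => ENNReal.ofReal_le_ofReal ?_)
        have hw := sumSq_nonneg w
        have hw' := sumSq_nonneg (w - w₀)
        gcongr ?_ * ?_
        refine Real.rpow_le_rpow_of_nonpos (by positivity) ?_ (by linarith)
        -- Separating `w` from `w₀` costs the factors `2` in `A'` and in the coefficient of `sumSq
        -- w`.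
        have h1 := mul_le_mul_of_nonneg_left (sumSq_sub_le w w₀) (inv_pos.2 hδ').le
        rw [hA', div_eq_mul_inv _ (1 + δ)]
        linarith

end ProjectedIntegral

/-! ### Orthonormal coordinates adapted to nested column spaces -/

section Coordinates

open Module

variable {n : ℕ} {κ₀ κ κ₁ κ₂ : Type*} [Fintype κ₀] [Fintype κ] [Fintype κ₁] [Fintype κ₂]

lemma sumSq_eq_norm_sq (x : κ → ℝ) : sumSq x = ‖WithLp.toLp 2 x‖ ^ 2 := by
  rw [EuclideanSpace.real_norm_sq_eq]; rfl

/-- The column space of a matrix, as a subspace of Euclidean space. -/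
noncomputable def colSpace (X : Matrix (Fin n) κ ℝ) : Submodule ℝ (EuclideanSpace ℝ (Fin n)) :=
  LinearMap.range ((WithLp.linearEquiv 2 ℝ (Fin n → ℝ)).symm.toLinearMap ∘ₗ X.mulVecLin)

lemma mem_colSpace {X : Matrix (Fin n) κ ℝ} {x : EuclideanSpace ℝ (Fin n)} :
    x ∈ colSpace X ↔ ∃ β, X *ᵥ β = x.ofLp := by
  rw [colSpace, LinearMap.mem_range]
  refine exists_congr fun β => ?_
  constructor
  · rintro rfl; rfl
  · intro h
    apply (WithLp.linearEquiv 2 ℝ (Fin n → ℝ)).injective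
    simpa using h

lemma finrank_colSpace {X : Matrix (Fin n) κ ℝ} (hX : LinearIndependent ℝ X.col) :
    finrank ℝ (colSpace X) = Fintype.card κ := by
  rw [colSpace, LinearMap.finrank_range_of_inj, finrank_fintype_fun_eq_card]
  exact (WithLp.linearEquiv 2 ℝ (Fin n → ℝ)).symm.injective.comp (Matrix.mulVec_injective_iff.2 hX)

lemma transpose_mulVec_eq_zero_of_mem_orthogonal {X : Matrix (Fin n) κ ℝ}
    {x : EuclideanSpace ℝ (Fin n)} (hx : x ∈ (colSpace X)ᗮ) : Xᵀ *ᵥ x.ofLp = 0 := by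
  classical
  ext j
  have h := (Submodule.mem_orthogonal _ _).1 hx (WithLp.toLp 2 (X *ᵥ Pi.single j 1))
    (mem_colSpace.2 ⟨_, rfl⟩)
  rw [PiLp.inner_apply, Matrix.mulVec_single_one] at h
  simpa [Matrix.mulVec, dotProduct, Matrix.transpose_apply, mul_comm] using h

/-- Orthonormal coordinates `(z, w, u)` of `ℝⁿ` adapted to nested column spaces: `u` parametrizes
the column space of `X₀` and `(w, u)` that of `X`. -/
structure AdaptedCoords (X₀ : Matrix (Fin n) κ₀ ℝ) (X : Matrix (Fin n) κ ℝ)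
    (κ₁ κ₂ : Type*) [Fintype κ₁] [Fintype κ₂] where
  toEquiv : ((κ₂ → ℝ) × (κ₁ → ℝ) × (κ₀ → ℝ)) ≃ₗ[ℝ] (Fin n → ℝ)
  measurePreserving : MeasurePreserving toEquiv
  sumSq_apply : ∀ z w u, sumSq (toEquiv (z, w, u)) = sumSq z + sumSq w + sumSq u
  exists_mulVec : ∀ w u, ∃ β, X *ᵥ β = toEquiv (0, w, u)
  exists_mulVec_ref : ∀ u, ∃ β, X₀ *ᵥ β = toEquiv (0, 0, u)
  transpose_mulVec : ∀ z, Xᵀ *ᵥ toEquiv (z, 0, 0) = 0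
  transpose_mulVec_ref : ∀ z w, X₀ᵀ *ᵥ toEquiv (z, w, 0) = 0

/-- Orthonormal bases of `Vᗮ`, `V₀ᗮ ⊓ V` and `V₀` are glued together; these spaces are pairwise
orthogonal and their dimensions add up. -/
lemma exists_orthonormalBasis_of_le {E : Type*} [NormedAddCommGroup E] [InnerProductSpace ℝ E]
    [FiniteDimensional ℝ E] {V₀ V : Submodule ℝ E} (hle : V₀ ≤ V)
    (h₀ : finrank ℝ V₀ = Fintype.card κ₀)
    (h₁ : Fintype.card κ₀ + Fintype.card κ₁ = finrank ℝ V)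
    (h₂ : finrank ℝ V + Fintype.card κ₂ = finrank ℝ E) :
    ∃ b : OrthonormalBasis (κ₂ ⊕ κ₁ ⊕ κ₀) ℝ E, (∀ i, b (Sum.inl i) ∈ Vᗮ) ∧
      (∀ i, b (Sum.inr (Sum.inl i)) ∈ V₀ᗮ ⊓ V) ∧ ∀ i, b (Sum.inr (Sum.inr i)) ∈ V₀ := by
  have d₁ := Submodule.finrank_add_inf_finrank_orthogonal hle
  have d₂ := Submodule.finrank_add_finrank_orthogonal V
  let b₀ : OrthonormalBasis κ₀ ℝ V₀ := (stdOrthonormalBasis ℝ V₀).reindex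
    (Fintype.equivOfCardEq (by simpa using h₀))
  let b₁ : OrthonormalBasis κ₁ ℝ (V₀ᗮ ⊓ V : Submodule ℝ E) :=
    (stdOrthonormalBasis ℝ (V₀ᗮ ⊓ V : Submodule ℝ E)).reindex
    (Fintype.equivOfCardEq (by rw [Fintype.card_fin]; omega))
  let b₂ : OrthonormalBasis κ₂ ℝ Vᗮ := (stdOrthonormalBasis ℝ Vᗮ).reindex
    (Fintype.equivOfCardEq (by rw [Fintype.card_fin]; omega))
  let v : κ₂ ⊕ κ₁ ⊕ κ₀ → E := Sum.elim (fun i => b₂ i) (Sum.elim (fun i => b₁ i) fun i => b₀ i)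
  have e₀ : ∀ i j, i ≠ j → inner ℝ (b₀ i : E) (b₀ j) = 0 := fun i j hij => b₀.orthonormal.2 hij
  have e₁ : ∀ i j, i ≠ j → inner ℝ (b₁ i : E) (b₁ j) = 0 := fun i j hij => b₁.orthonormal.2 hij
  have e₂ : ∀ i j, i ≠ j → inner ℝ (b₂ i : E) (b₂ j) = 0 := fun i j hij => b₂.orthonormal.2 hij
  have e₁₀ : ∀ i j, inner ℝ (b₁ i : E) (b₀ j) = 0 := fun i j =>
    Submodule.inner_left_of_mem_orthogonal (b₀ j).2 (b₁ i).2.1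
  have e₂₀ : ∀ i j, inner ℝ (b₂ i : E) (b₀ j) = 0 := fun i j =>
    Submodule.inner_left_of_mem_orthogonal (hle (b₀ j).2) (b₂ i).2
  have e₂₁ : ∀ i j, inner ℝ (b₂ i : E) (b₁ j) = 0 := fun i j =>
    Submodule.inner_left_of_mem_orthogonal (b₁ j).2.2 (b₂ i).2
  have hv : Orthonormal ℝ v := by
    constructor
    · rintro (i | i | i)
      · exact b₂.orthonormal.1 i
      · exact b₁.orthonormal.1 i
      · exact b₀.orthonormal.1 i
    · rintro (i | i | i) (j | j | j) hij
      · exact e₂ i j (by simpa using hij)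
      · exact e₂₁ i j
      · exact e₂₀ i j
      · exact (real_inner_comm _ _).trans (e₂₁ j i)
      · exact e₁ i j (by simpa using hij)
      · exact e₁₀ i j
      · exact (real_inner_comm _ _).trans (e₂₀ j i)
      · exact (real_inner_comm _ _).trans (e₁₀ j i)
      · exact e₀ i j (by simpa using hij)
  have hspan : ⊤ ≤ Submodule.span ℝ (Set.range v) := by
    rw [hv.linearIndependent.span_eq_top_of_card_eq_finrank']
    simp only [Fintype.card_sum]
    omega
  refine ⟨OrthonormalBasis.mk hv hspan, fun i => ?_, fun i => ?_, fun i => ?_⟩ <;>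
    rw [OrthonormalBasis.coe_mk]
  · exact (b₂ i).2
  · exact (b₁ i).2
  · exact (b₀ i).2

lemma exists_adaptedCoords {X₀ : Matrix (Fin n) κ₀ ℝ} {X : Matrix (Fin n) κ ℝ}
    (hX₀ : LinearIndependent ℝ X₀.col) (hX : LinearIndependent ℝ X.col)
    (hsub : ∀ β₀, ∃ β, X *ᵥ β = X₀ *ᵥ β₀)
    (h₁ : Fintype.card κ₀ + Fintype.card κ₁ = Fintype.card κ)
    (h₂ : Fintype.card κ + Fintype.card κ₂ = n) :
    Nonempty (AdaptedCoords X₀ X κ₁ κ₂) := by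
  have hle : colSpace X₀ ≤ colSpace X := fun x hx => by
    obtain ⟨β₀, h⟩ := mem_colSpace.1 hx
    obtain ⟨β, h'⟩ := hsub β₀
    exact mem_colSpace.2 ⟨β, h'.trans h⟩
  obtain ⟨b, hb₂, hb₁, hb₀⟩ := exists_orthonormalBasis_of_le (κ₀ := κ₀) (κ₁ := κ₁) (κ₂ := κ₂) hle
    (finrank_colSpace hX₀) (by rw [finrank_colSpace hX, h₁])
    (by rw [finrank_colSpace hX, h₂, finrank_euclideanSpace_fin])
  let e₁ : ((κ₂ → ℝ) × (κ₁ → ℝ) × (κ₀ → ℝ)) ≃ₗ[ℝ] (κ₂ ⊕ κ₁ ⊕ κ₀ → ℝ) :=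
    ((LinearEquiv.refl ℝ _).prodCongr (LinearEquiv.sumArrowLequivProdArrow κ₁ κ₀ ℝ ℝ).symm).trans
      (LinearEquiv.sumArrowLequivProdArrow κ₂ (κ₁ ⊕ κ₀) ℝ ℝ).symm
  let Φ : ((κ₂ → ℝ) × (κ₁ → ℝ) × (κ₀ → ℝ)) ≃ₗ[ℝ] (Fin n → ℝ) :=
    e₁.trans ((WithLp.linearEquiv 2 ℝ _).symm.trans
      (b.repr.symm.toLinearEquiv.trans (WithLp.linearEquiv 2 ℝ _)))
  have hΦ : ∀ a, WithLp.toLp 2 (Φ a) = b.repr.symm (WithLp.toLp 2 (e₁ a)) := fun a => rfl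
  have hsum : ∀ z w u, WithLp.toLp 2 (Φ (z, w, u)) = ∑ i, z i • b (Sum.inl i)
      + (∑ i, w i • b (Sum.inr (Sum.inl i)) + ∑ i, u i • b (Sum.inr (Sum.inr i))) :=
    fun z w u => by
      rw [hΦ, ← OrthonormalBasis.sum_repr_symm, Fintype.sum_sum_type, Fintype.sum_sum_type]
      rfl
  have hmp : MeasurePreserving Φ := by
    have m₁ : MeasurePreserving e₁ :=
      (volume_measurePreserving_sumPiEquivProdPi_symm fun _ : κ₂ ⊕ κ₁ ⊕ κ₀ => ℝ).comp
        ((MeasurePreserving.id volume).prod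
          (volume_measurePreserving_sumPiEquivProdPi_symm fun _ : κ₁ ⊕ κ₀ => ℝ))
    exact (PiLp.volume_preserving_ofLp (Fin n)).comp (b.measurePreserving_repr_symm.comp
      ((PiLp.volume_preserving_toLp _).comp m₁))
  refine ⟨⟨Φ, hmp, fun z w u => ?_, fun w u => ?_, fun u => ?_, fun z => ?_, fun z w => ?_⟩⟩
  · rw [sumSq_eq_norm_sq, hΦ, LinearIsometryEquiv.norm_map, ← sumSq_eq_norm_sq, sumSq, Fintype.sum_sum_type,
      Fintype.sum_sum_type, ← add_assoc]
    rfl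
  · refine (mem_colSpace (x := WithLp.toLp 2 (Φ (0, w, u)))).1 ?_
    rw [hsum]
    refine add_mem (by simp) (add_mem (sum_mem fun i _ => ?_) (sum_mem fun i _ => ?_))
    · exact Submodule.smul_mem _ _ (hb₁ i).2
    · exact Submodule.smul_mem _ _ (hle (hb₀ i))
  · refine (mem_colSpace (x := WithLp.toLp 2 (Φ (0, 0, u)))).1 ?_
    rw [hsum]
    refine add_mem (by simp) (add_mem (by simp) (sum_mem fun i _ => ?_))
    exact Submodule.smul_mem _ _ (hb₀ i)
  · refine transpose_mulVec_eq_zero_of_mem_orthogonal (x := WithLp.toLp 2 (Φ (z, 0, 0))) ?_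
    rw [hsum]
    refine add_mem (sum_mem fun i _ => ?_) (by simp)
    exact Submodule.smul_mem _ _ (hb₂ i)
  · refine transpose_mulVec_eq_zero_of_mem_orthogonal (x := WithLp.toLp 2 (Φ (z, w, 0))) ?_
    rw [hsum]
    refine add_mem (sum_mem fun i _ => ?_) (add_mem (sum_mem fun i _ => ?_) (by simp))
    · exact Submodule.smul_mem _ _ (Submodule.orthogonal_le hle (hb₂ i))
    · exact Submodule.smul_mem _ _ (hb₁ i).1

end Coordinates

/-! ### Closed forms for the predictive and joint densities -/

section Densities

variable {m : ℕ} {κ : Type*} [Fintype κ]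

lemma normalDensity_eq (μ : Fin m → ℝ) (v : ℝ) (y : Fin m → ℝ) :
    normalDensity μ v y
      = (2 * Real.pi * v) ^ (-((m : ℝ) / 2)) * Real.exp (-((2 * v)⁻¹ * sumSq (y - μ))) := by
  rw [normalDensity, sumSq, neg_div, neg_div, div_eq_inv_mul (∑ i, _)]
  rfl

lemma normalDensity_pos (μ : Fin m → ℝ) {v : ℝ} (hv : 0 < v) (y : Fin m → ℝ) :
    0 < normalDensity μ v y := by
  unfold normalDensity; positivity

lemma lintegral_normalDensity (μ : Fin m → ℝ) {v : ℝ} (hv : 0 < v) :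
    ∫⁻ y : Fin m → ℝ, ENNReal.ofReal (normalDensity μ v y) = 1 := by
  simp_rw [normalDensity_eq, ENNReal.ofReal_mul
    (show 0 ≤ (2 * Real.pi * v) ^ (-((m : ℝ) / 2)) by positivity)]
  rw [lintegral_const_mul' _ _ ENNReal.ofReal_ne_top,
    lintegral_sub_right_eq_self
      (fun y : Fin m → ℝ => ENNReal.ofReal (Real.exp (-((2 * v)⁻¹ * sumSq y)))) μ,
    lintegral_exp_neg_mul_sumSq (by positivity), ← ENNReal.ofReal_mul (by positivity),
    Fintype.card_fin, div_inv_eq_mul, Real.rpow_neg (by positivity),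
    show Real.pi * (2 * v) = 2 * Real.pi * v by ring, inv_mul_cancel₀ (by positivity),
    ENNReal.ofReal_one]

lemma normalDensity_rpow_inv (μ : Fin m → ℝ) {v δ : ℝ} (hv : 0 < v) (hδ : 0 < δ)
    (y : Fin m → ℝ) :
    normalDensity μ v y ^ (1 / δ)
      = ((2 * Real.pi * v) ^ (-((m : ℝ) / 2))) ^ (1 / δ) * (2 * Real.pi * (δ * v)) ^ ((m : ℝ) / 2)
        * normalDensity μ (δ * v) y := by
  rw [normalDensity_eq, normalDensity_eq, Real.mul_rpow (by positivity) (Real.exp_pos _).le,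
    ← Real.exp_mul, Real.rpow_neg (x := 2 * Real.pi * (δ * v)) (by positivity)]
  have : -((2 * v)⁻¹ * sumSq (y - μ)) * (1 / δ) = -((2 * (δ * v))⁻¹ * sumSq (y - μ)) := by
    field_simp
  rw [this]
  field_simp

/-- The power `1 / δ` multiplies the variance by `δ`; every other factor is free of the data and is
removed by the normalization. -/
lemma powerLikelihood_eq (X : Matrix (Fin m) κ ℝ) (β : κ → ℝ) {v δ : ℝ} (hv : 0 < v)
    (hδ : 0 < δ) (y : Fin m → ℝ) :
    powerLikelihood δ X β v y = ENNReal.ofReal (normalDensity (X *ᵥ β) (δ * v) y) := by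
  have h : ∀ z, likelihood X β v z ^ (1 / δ)
      = ENNReal.ofReal (((2 * Real.pi * v) ^ (-((m : ℝ) / 2))) ^ (1 / δ)
          * (2 * Real.pi * (δ * v)) ^ ((m : ℝ) / 2))
        * ENNReal.ofReal (normalDensity (X *ᵥ β) (δ * v) z) := fun z => by
    rw [likelihood, ENNReal.ofReal_rpow_of_pos (normalDensity_pos _ hv _),
      normalDensity_rpow_inv _ hv hδ, ENNReal.ofReal_mul (by positivity)]
  simp_rw [powerLikelihood, h]
  rw [lintegral_const_mul' _ _ ENNReal.ofReal_ne_top, lintegral_normalDensity _ (by positivity),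
    mul_one, ENNReal.mul_div_right_comm, ENNReal.div_self _ ENNReal.ofReal_ne_top, one_mul]
  exact (ENNReal.ofReal_pos.2 (by positivity)).ne'

lemma lintegral_lintegral_inv_gamma_mulVec (X : Matrix (Fin m) κ ℝ) (β₀ : κ → ℝ) {p Q lam : ℝ}
    (hp : (Fintype.card κ : ℝ) / 2 < p) (hQ : 0 < Q) (hlam : 0 < lam) :
    ∫⁻ β : κ → ℝ, ∫⁻ v in Set.Ioi (0 : ℝ), ENNReal.ofReal
        (v ^ (-p - 1) * Real.exp (-((Q + lam * sumSq (X *ᵥ (β - β₀))) / v)))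
      = ENNReal.ofReal (lam ^ (-((Fintype.card κ : ℝ) / 2))
          * (Real.Gamma (p - (Fintype.card κ : ℝ) / 2)
            * Q ^ (-(p - (Fintype.card κ : ℝ) / 2)))) * gramIntegral X := by
  rw [lintegral_lintegral_swap (by fun_prop)]
  set k : ℝ := (Fintype.card κ : ℝ) / 2 with hk
  have h : ∀ v ∈ Set.Ioi (0 : ℝ), ∫⁻ β : κ → ℝ, ENNReal.ofReal
        (v ^ (-p - 1) * Real.exp (-((Q + lam * sumSq (X *ᵥ (β - β₀))) / v)))
      = ENNReal.ofReal (v ^ (-(p - k) - 1) * Real.exp (-(Q / v)))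
        * (ENNReal.ofReal (lam ^ (-k)) * gramIntegral X) := fun v hv => by
    have hv : (0 : ℝ) < v := hv
    have h' : ∀ β : κ → ℝ, ENNReal.ofReal
        (v ^ (-p - 1) * Real.exp (-((Q + lam * sumSq (X *ᵥ (β - β₀))) / v)))
        = ENNReal.ofReal (v ^ (-p - 1) * Real.exp (-(Q / v)))
          * ENNReal.ofReal (Real.exp (-((lam / v) * sumSq (X *ᵥ (β - β₀))))) := fun β => by
      rw [← ENNReal.ofReal_mul (by positivity), mul_assoc, ← Real.exp_add]
      congr 3
      ring
    simp_rw [h']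
    rw [lintegral_const_mul' _ _ ENNReal.ofReal_ne_top,
      lintegral_exp_neg_mul_sumSq_mulVec X β₀ (by positivity), ← mul_assoc, ← mul_assoc, ← hk,
      ← ENNReal.ofReal_mul (by positivity), ← ENNReal.ofReal_mul (by positivity)]
    congr 2
    rw [Real.div_rpow hlam.le hv.le, show -(p - k) - 1 = -p - 1 - (-k) by ring,
      Real.rpow_sub hv (-p - 1) (-k)]
    ring
  rw [setLIntegral_congr_fun measurableSet_Ioi h, lintegral_mul_const _ (by fun_prop),
    lintegral_inv_gamma (sub_pos.2 hp) hQ, ← mul_assoc,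
    ← ENNReal.ofReal_mul (mul_pos (Real.Gamma_pos_of_pos (sub_pos.2 hp)) (by positivity)).le,
    mul_comm (lam ^ _)]

lemma sumSq_mulVec_add {X : Matrix (Fin m) κ ℝ} {r : Fin m → ℝ} (hr : Xᵀ *ᵥ r = 0)
    (β : κ → ℝ) : sumSq (X *ᵥ β + r) = sumSq (X *ᵥ β) + sumSq r := by
  have h : (X *ᵥ β) ⬝ᵥ r = 0 := by
    rw [dotProduct_comm, Matrix.dotProduct_mulVec, ← Matrix.mulVec_transpose, hr, zero_dotProduct]
  simp only [sumSq_eq_dotProduct, add_dotProduct, dotProduct_add, h, dotProduct_comm r (X *ᵥ β)]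
  ring

lemma sumSq_sub_mulVec {X : Matrix (Fin m) κ ℝ} {r : Fin m → ℝ} (hr : Xᵀ *ᵥ r = 0)
    (β₀ β : κ → ℝ) :
    sumSq (X *ᵥ β₀ + r - X *ᵥ β) = sumSq r + sumSq (X *ᵥ (β - β₀)) := by
  rw [show X *ᵥ β₀ + r - X *ᵥ β = X *ᵥ (β₀ - β) + r by rw [Matrix.mulVec_sub]; abel,
    sumSq_mulVec_add hr, add_comm, ← neg_sub β β₀, Matrix.mulVec_neg]
  congr 1
  simp [sumSq]

/-- Pythagoras splits off the residual, leaving a Gaussian integral in `β` and an inverse Gamma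
integral in `v`. The value is free of `δ` because `dv / v` is invariant under scaling. -/
lemma priorPredictive_jeffreys {X : Matrix (Fin m) κ ℝ} {r : Fin m → ℝ} (hr : Xᵀ *ᵥ r = 0)
    (hr0 : r ≠ 0) (β₀ : κ → ℝ) {c δ : ℝ} (hc : 0 < c) (hδ : 0 < δ) (hm : Fintype.card κ < m) :
    priorPredictive δ X (jeffreys c) (X *ᵥ β₀ + r)
      = ENNReal.ofReal (c * Real.pi ^ (-((m : ℝ) / 2))
          * Real.Gamma (((m : ℝ) - Fintype.card κ) / 2)
          * sumSq r ^ (-(((m : ℝ) - Fintype.card κ) / 2))) * gramIntegral X := by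
  have hR := sumSq_pos hr0
  have hm' : (Fintype.card κ : ℝ) < m := by exact_mod_cast hm
  have h : ∀ β : κ → ℝ, ∫⁻ v in Set.Ioi (0 : ℝ),
      powerLikelihood δ X β v (X *ᵥ β₀ + r) * jeffreys c β v
      = ENNReal.ofReal (c * (2 * Real.pi * δ) ^ (-((m : ℝ) / 2)))
        * ∫⁻ v in Set.Ioi (0 : ℝ), ENNReal.ofReal (v ^ (-((m : ℝ) / 2) - 1) * Real.exp
          (-(((2 * δ)⁻¹ * sumSq r + (2 * δ)⁻¹ * sumSq (X *ᵥ (β - β₀))) / v))) := fun β => by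
    rw [← lintegral_const_mul' _ _ ENNReal.ofReal_ne_top]
    refine setLIntegral_congr_fun measurableSet_Ioi fun v hv => ?_
    have hv : (0 : ℝ) < v := hv
    rw [powerLikelihood_eq X β hv hδ, jeffreys,
      ← ENNReal.ofReal_mul (normalDensity_pos _ (by positivity) _).le,
      ← ENNReal.ofReal_mul (by positivity), normalDensity_eq, sumSq_sub_mulVec hr,
      ← mul_assoc (2 * Real.pi), Real.mul_rpow (by positivity) hv.le,
      Real.rpow_sub hv, Real.rpow_one]
    have e : (2 * (δ * v))⁻¹ * (sumSq r + sumSq (X *ᵥ (β - β₀)))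
        = ((2 * δ)⁻¹ * sumSq r + (2 * δ)⁻¹ * sumSq (X *ᵥ (β - β₀))) / v := by
      field_simp
    rw [e]
    congr 1
    ring
  simp_rw [priorPredictive, h]
  rw [lintegral_const_mul' _ _ ENNReal.ofReal_ne_top,
    lintegral_lintegral_inv_gamma_mulVec X β₀ (by linarith) (by positivity) (by positivity),
    ← mul_assoc, ← ENNReal.ofReal_mul (by positivity)]
  congr 2
  set k : ℝ := (Fintype.card κ : ℝ)
  rw [show (m : ℝ) / 2 - k / 2 = ((m : ℝ) - k) / 2 by ring, Real.mul_rpow (by positivity) hR.le,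
    show 2 * Real.pi * δ = Real.pi * (2 * δ) by ring, Real.mul_rpow (by positivity) (by positivity),
    Real.inv_rpow (by positivity), Real.inv_rpow (by positivity)]
  simp only [← Real.rpow_neg (show 0 ≤ 2 * δ by positivity), neg_neg]
  have e : (2 * δ) ^ (-((m : ℝ) / 2)) * ((2 * δ) ^ (k / 2) * (2 * δ) ^ (((m : ℝ) - k) / 2)) = 1 := by
    rw [← Real.rpow_add (by positivity), ← Real.rpow_add (by positivity),
      show -((m : ℝ) / 2) + (k / 2 + ((m : ℝ) - k) / 2) = 0 by ring, Real.rpow_zero]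
  linear_combination (c * Real.pi ^ (-((m : ℝ) / 2)) * Real.Gamma (((m : ℝ) - k) / 2)
    * sumSq r ^ (-(((m : ℝ) - k) / 2))) * e

/-- Completing the square in the joint density of the observed and the imaginary data. -/
lemma sumSq_mulVec_sub_add (X : Matrix (Fin m) κ ℝ) (β β₁ β₂ : κ → ℝ) {δ : ℝ} (hδ : 0 < δ) :
    sumSq (X *ᵥ (β - β₁)) + δ⁻¹ * sumSq (X *ᵥ (β - β₂))
      = (1 + δ⁻¹) * sumSq (X *ᵥ (β - (1 + δ)⁻¹ • (δ • β₁ + β₂)))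
        + (1 + δ)⁻¹ * sumSq (X *ᵥ (β₁ - β₂)) := by
  simp only [Matrix.mulVec_sub, Matrix.mulVec_smul, Matrix.mulVec_add, sumSq, Finset.mul_sum,
    ← Finset.sum_add_distrib]
  refine Finset.sum_congr rfl fun i _ => ?_
  simp only [Pi.sub_apply, Pi.add_apply, Pi.smul_apply, smul_eq_mul]
  field_simp
  ring

/-- The product of the likelihood, the power likelihood and the Jeffreys prior. -/
lemma likelihood_mul_powerLikelihood_mul_jeffreys (X : Matrix (Fin m) κ ℝ) (β : κ → ℝ)
    {c δ v : ℝ} (hc : 0 < c) (hδ : 0 < δ) (hv : 0 < v) (y z : Fin m → ℝ) :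
    likelihood X β v y * (powerLikelihood δ X β v z * jeffreys c β v)
      = ENNReal.ofReal (c * (2 * Real.pi) ^ (-(m : ℝ)) * δ ^ (-((m : ℝ) / 2)))
        * ENNReal.ofReal (v ^ (-(m : ℝ) - 1) * Real.exp
          (-(2⁻¹ * (sumSq (y - X *ᵥ β) + δ⁻¹ * sumSq (z - X *ᵥ β)) / v))) := by
  rw [likelihood, powerLikelihood_eq X β hv hδ, jeffreys,
    ← ENNReal.ofReal_mul (normalDensity_pos _ (by positivity) _).le,
    ← ENNReal.ofReal_mul (normalDensity_pos _ hv _).le,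
    ← ENNReal.ofReal_mul (by positivity), normalDensity_eq, normalDensity_eq]
  congr 1
  have e : Real.exp (-(2⁻¹ * (sumSq (y - X *ᵥ β) + δ⁻¹ * sumSq (z - X *ᵥ β)) / v))
      = Real.exp (-((2 * v)⁻¹ * sumSq (y - X *ᵥ β)))
        * Real.exp (-((2 * (δ * v))⁻¹ * sumSq (z - X *ᵥ β))) := by
    rw [← Real.exp_add]
    congr 1
    field_simp
    ring
  have e' : (2 * Real.pi) ^ (-(m : ℝ)) = (2 * Real.pi) ^ (-((m : ℝ) / 2))
      * (2 * Real.pi) ^ (-((m : ℝ) / 2)) := by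
    rw [← Real.rpow_add (by positivity)]; congr 1; ring
  have e'' : v ^ (-(m : ℝ)) = v ^ (-((m : ℝ) / 2)) * v ^ (-((m : ℝ) / 2)) := by
    rw [← Real.rpow_add (by positivity)]; congr 1; ring
  rw [e, e', Real.rpow_sub hv, Real.rpow_one, e'', Real.mul_rpow (y := v) (by positivity) hv.le,
    Real.mul_rpow (y := δ * v) (by positivity) (by positivity), Real.mul_rpow hδ.le hv.le]
  ring

lemma lintegral_likelihood_mul_powerLikelihood {X : Matrix (Fin m) κ ℝ} {r₁ r₂ : Fin m → ℝ}
    (hr₁ : Xᵀ *ᵥ r₁ = 0) (hr₂ : Xᵀ *ᵥ r₂ = 0) (hr0 : r₁ ≠ 0) (β₁ β₂ : κ → ℝ) {c δ : ℝ}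
    (hc : 0 < c) (hδ : 0 < δ) (hm : Fintype.card κ < m) :
    ∫⁻ β : κ → ℝ, ∫⁻ v in Set.Ioi (0 : ℝ), likelihood X β v (X *ᵥ β₁ + r₁)
        * (powerLikelihood δ X β v (X *ᵥ β₂ + r₂) * jeffreys c β v)
      = ENNReal.ofReal (c * Real.pi ^ (-(m : ℝ)) * δ ^ (-((m : ℝ) / 2))
          * (1 + δ⁻¹) ^ (-((Fintype.card κ : ℝ) / 2))
          * Real.Gamma ((m : ℝ) - (Fintype.card κ : ℝ) / 2)
          * (sumSq r₁ + sumSq r₂ / δ + sumSq (X *ᵥ (β₁ - β₂)) / (1 + δ))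
            ^ (-((m : ℝ) - (Fintype.card κ : ℝ) / 2))) * gramIntegral X := by
  have hm' : (Fintype.card κ : ℝ) < m := by exact_mod_cast hm
  have hR := sumSq_pos hr0
  have hR₂ := sumSq_nonneg r₂
  have hX := sumSq_nonneg (X *ᵥ (β₁ - β₂))
  set Q : ℝ := sumSq r₁ + sumSq r₂ / δ + sumSq (X *ᵥ (β₁ - β₂)) / (1 + δ) with hQ
  have hQ0 : 0 < Q := by positivity
  have h : ∀ β : κ → ℝ, ∫⁻ v in Set.Ioi (0 : ℝ), likelihood X β v (X *ᵥ β₁ + r₁)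
        * (powerLikelihood δ X β v (X *ᵥ β₂ + r₂) * jeffreys c β v)
      = ENNReal.ofReal (c * (2 * Real.pi) ^ (-(m : ℝ)) * δ ^ (-((m : ℝ) / 2)))
        * ∫⁻ v in Set.Ioi (0 : ℝ), ENNReal.ofReal (v ^ (-(m : ℝ) - 1) * Real.exp
          (-((2⁻¹ * Q + 2⁻¹ * (1 + δ⁻¹)
            * sumSq (X *ᵥ (β - (1 + δ)⁻¹ • (δ • β₁ + β₂)))) / v))) := fun β => by
    rw [← lintegral_const_mul' _ _ ENNReal.ofReal_ne_top]
    refine setLIntegral_congr_fun measurableSet_Ioi fun v hv => ?_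
    rw [likelihood_mul_powerLikelihood_mul_jeffreys X β hc hδ hv, sumSq_sub_mulVec hr₁,
      sumSq_sub_mulVec hr₂]
    have e := sumSq_mulVec_sub_add X β β₁ β₂ hδ
    have e2 : 2⁻¹ * (sumSq r₁ + sumSq (X *ᵥ (β - β₁))
          + δ⁻¹ * (sumSq r₂ + sumSq (X *ᵥ (β - β₂))))
        = 2⁻¹ * Q + 2⁻¹ * (1 + δ⁻¹) * sumSq (X *ᵥ (β - (1 + δ)⁻¹ • (δ • β₁ + β₂))) := by
      rw [hQ]
      linear_combination 2⁻¹ * e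
    rw [e2]
  simp_rw [h]
  rw [lintegral_const_mul' _ _ ENNReal.ofReal_ne_top,
    lintegral_lintegral_inv_gamma_mulVec X _ (by linarith) (by positivity) (by positivity),
    ← mul_assoc, ← ENNReal.ofReal_mul (by positivity)]
  congr 2
  set k : ℝ := (Fintype.card κ : ℝ)
  rw [Real.mul_rpow (x := 2⁻¹) (y := 1 + δ⁻¹) (by positivity) (by positivity),
    Real.mul_rpow (x := 2⁻¹) (y := Q) (by positivity) hQ0.le,
    Real.mul_rpow (x := 2) (y := Real.pi) (by positivity) (by positivity),
    Real.inv_rpow (by positivity), Real.inv_rpow (by positivity)]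
  simp only [← Real.rpow_neg (show (0 : ℝ) ≤ 2 by positivity), neg_neg]
  have e : (2 : ℝ) ^ (-(m : ℝ)) * (2 ^ (k / 2) * 2 ^ ((m : ℝ) - k / 2)) = 1 := by
    rw [← Real.rpow_add (by positivity), ← Real.rpow_add (by positivity),
      show -(m : ℝ) + (k / 2 + ((m : ℝ) - k / 2)) = 0 by ring, Real.rpow_zero]
  linear_combination (c * Real.pi ^ (-(m : ℝ)) * δ ^ (-((m : ℝ) / 2)) * (1 + δ⁻¹) ^ (-(k / 2))
    * Real.Gamma ((m : ℝ) - k / 2) * Q ^ (-((m : ℝ) - k / 2))) * e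

end Densities

lemma lintegral_lintegral_lintegral_rotate {α β γ : Type*} [MeasurableSpace α]
    [MeasurableSpace β] [MeasurableSpace γ] {μ : Measure α} {ν : Measure β} {ρ : Measure γ}
    [SFinite μ] [SFinite ν] [SFinite ρ] {f : α → β → γ → ℝ≥0∞}
    (hf : Measurable fun p : (α × β) × γ => f p.1.1 p.1.2 p.2) :
    ∫⁻ a, ∫⁻ b, ∫⁻ c, f a b c ∂ρ ∂ν ∂μ = ∫⁻ c, ∫⁻ a, ∫⁻ b, f a b c ∂ν ∂μ ∂ρ := by
  have h1 : ∀ c, ∫⁻ a, ∫⁻ b, f a b c ∂ν ∂μ = ∫⁻ p, f p.1 p.2 c ∂(μ.prod ν) := fun c =>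
    lintegral_lintegral (f := fun a b => f a b c)
      (hf.comp (measurable_id.prodMk measurable_const)).aemeasurable
  have h2 : ∫⁻ a, ∫⁻ b, ∫⁻ c, f a b c ∂ρ ∂ν ∂μ
      = ∫⁻ p, ∫⁻ c, f p.1 p.2 c ∂ρ ∂(μ.prod ν) :=
    lintegral_lintegral (f := fun a b => ∫⁻ c, f a b c ∂ρ)
      (hf.lintegral_prod_right').aemeasurable
  simp_rw [h1]
  rw [h2]
  exact lintegral_lintegral_swap hf.aemeasurable

/-! ### The marginal likelihood as an integral in adapted coordinates -/

section Marginal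

variable {n : ℕ} {κ₀ κ κ₁ κ₂ : Type*} [Fintype κ₀] [Fintype κ] [Fintype κ₁] [Fintype κ₂]

/-- The function `ρ` is a measurable, everywhere finite version of the ratio of predictives, so
Tonelli applies without measurability of the predictives themselves. -/
lemma marginalLikelihood_pepPrior {X₀ : Matrix (Fin n) κ₀ ℝ} {X : Matrix (Fin n) κ ℝ}
    {prior₀ : (κ₀ → ℝ) → ℝ → ℝ≥0∞} {c δ : ℝ} (hc : 0 < c) (hδ : 0 < δ) (y : Fin n → ℝ)
    {ρ : (Fin n → ℝ) → ℝ≥0∞} (hρm : Measurable ρ) (hρt : ∀ z, ρ z ≠ ⊤)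
    (hρ : (fun z => (priorPredictive δ X (jeffreys c) z)⁻¹ * priorPredictive δ X₀ prior₀ z)
      =ᵐ[volume] ρ) :
    marginalLikelihood X (pepPrior δ X₀ prior₀ X (jeffreys c)) y
      = ∫⁻ z : Fin n → ℝ, ρ z * ∫⁻ β : κ → ℝ, ∫⁻ v in Set.Ioi (0 : ℝ),
          likelihood X β v y * (powerLikelihood δ X β v z * jeffreys c β v) := by
  set E : (κ → ℝ) → ℝ → (Fin n → ℝ) → ℝ≥0∞ := fun β v z =>
    ENNReal.ofReal (c * (2 * Real.pi) ^ (-(n : ℝ)) * δ ^ (-((n : ℝ) / 2)))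
        * ENNReal.ofReal (v ^ (-(n : ℝ) - 1) * Real.exp
          (-(2⁻¹ * (sumSq (y - X *ᵥ β) + δ⁻¹ * sumSq (z - X *ᵥ β)) / v))) with hE
  have hEv : ∀ β, ∀ v ∈ Set.Ioi (0 : ℝ), ∀ z,
      likelihood X β v y * (powerLikelihood δ X β v z * jeffreys c β v) = E β v z :=
    fun β v hv z => likelihood_mul_powerLikelihood_mul_jeffreys X β hc hδ hv y z
  have hinner : ∀ z, ∫⁻ β : κ → ℝ, ∫⁻ v in Set.Ioi (0 : ℝ),
      likelihood X β v y * (powerLikelihood δ X β v z * jeffreys c β v)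
      = ∫⁻ β : κ → ℝ, ∫⁻ v in Set.Ioi (0 : ℝ), E β v z := fun z =>
    lintegral_congr fun β => setLIntegral_congr_fun measurableSet_Ioi fun v hv => hEv β v hv z
  have hmarg : marginalLikelihood X (pepPrior δ X₀ prior₀ X (jeffreys c)) y
      = ∫⁻ β : κ → ℝ, ∫⁻ v in Set.Ioi (0 : ℝ), ∫⁻ z : Fin n → ℝ, E β v z * ρ z := by
    refine lintegral_congr fun β => setLIntegral_congr_fun measurableSet_Ioi fun v hv => ?_
    rw [pepPrior, ← lintegral_const_mul' _ _ (by simp [likelihood])]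
    refine lintegral_congr_ae ?_
    filter_upwards [hρ] with z hz
    rw [← hz, ← hEv β v hv z, imaginaryPosterior, div_eq_mul_inv]
    ring
  have hEm : Measurable fun p : ((κ → ℝ) × ℝ) × (Fin n → ℝ) => E p.1.1 p.1.2 p.2 * ρ p.2 := by
    rw [hE]
    fun_prop
  rw [hmarg, lintegral_lintegral_lintegral_rotate hEm]
  refine lintegral_congr fun z => ?_
  rw [hinner, mul_comm, ← lintegral_mul_const' _ _ (hρt z)]
  refine lintegral_congr fun β => ?_
  rw [lintegral_mul_const' _ _ (hρt z)]

namespace AdaptedCoords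

variable {X₀ : Matrix (Fin n) κ₀ ℝ} {X : Matrix (Fin n) κ ℝ} (e : AdaptedCoords X₀ X κ₁ κ₂)

/-- The coordinate map as a measurable equivalence. -/
noncomputable def measurableEquiv : ((κ₂ → ℝ) × (κ₁ → ℝ) × (κ₀ → ℝ)) ≃ᵐ (Fin n → ℝ) :=
  e.toEquiv.toContinuousLinearEquiv.toHomeomorph.toMeasurableEquiv

lemma coe_measurableEquiv : ⇑e.measurableEquiv = e.toEquiv := rfl

lemma measurePreserving_measurableEquiv : MeasurePreserving e.measurableEquiv :=
  e.measurePreserving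

lemma exists_eq_mulVec_add (z : κ₂ → ℝ) (w : κ₁ → ℝ) (u : κ₀ → ℝ) :
    ∃ β, X *ᵥ β = e.toEquiv (0, w, u) ∧ e.toEquiv (z, w, u) = X *ᵥ β + e.toEquiv (z, 0, 0) := by
  obtain ⟨β, hβ⟩ := e.exists_mulVec w u
  refine ⟨β, hβ, ?_⟩
  rw [hβ, ← map_add]
  simp

lemma exists_eq_mulVec_ref_add (z : κ₂ → ℝ) (w : κ₁ → ℝ) (u : κ₀ → ℝ) :
    ∃ β, e.toEquiv (z, w, u) = X₀ *ᵥ β + e.toEquiv (z, w, 0) := by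
  obtain ⟨β, hβ⟩ := e.exists_mulVec_ref u
  refine ⟨β, ?_⟩
  rw [hβ, ← map_add]
  simp

lemma sumSq_residual (z : κ₂ → ℝ) : sumSq (e.toEquiv (z, 0, 0)) = sumSq z := by
  rw [e.sumSq_apply]; simp

lemma sumSq_residual_ref (z : κ₂ → ℝ) (w : κ₁ → ℝ) :
    sumSq (e.toEquiv (z, w, 0)) = sumSq z + sumSq w := by
  rw [e.sumSq_apply]; simp

include e in
lemma card_eq : n = Fintype.card κ₂ + (Fintype.card κ₁ + Fintype.card κ₀) := by
  have := e.toEquiv.finrank_eq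
  simpa using this.symm

/-- Imaginary data inside the column space, where the closed form of the predictive is not
available, are negligible. -/
lemma ae_fst_ne_zero (hN : 0 < Fintype.card κ₂) :
    ∀ᵐ y : Fin n → ℝ, (e.measurableEquiv.symm y).1 ≠ 0 := by
  have : Nonempty κ₂ := Fintype.card_pos_iff.1 hN
  have h0 : ∀ᵐ z : κ₂ → ℝ, z ≠ 0 := compl_mem_ae_iff.2 (measure_singleton (0 : κ₂ → ℝ))
  exact e.measurePreserving_measurableEquiv.symm.quasiMeasurePreserving.ae
    (Measure.quasiMeasurePreserving_fst.ae h0)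

lemma inv_priorPredictive_mul_priorPredictive
    (hX : LinearIndependent ℝ X.col) {c₀ c δ : ℝ} (hc₀ : 0 < c₀) (hc : 0 < c) (hδ : 0 < δ)
    (hcard : Fintype.card κ₀ + Fintype.card κ₁ = Fintype.card κ) (hN : 0 < Fintype.card κ₂)
    {z : κ₂ → ℝ} (hz : z ≠ 0) (w : κ₁ → ℝ) (u : κ₀ → ℝ) :
    (priorPredictive δ X (jeffreys c) (e.toEquiv (z, w, u)))⁻¹
        * priorPredictive δ X₀ (jeffreys c₀) (e.toEquiv (z, w, u))
      = ENNReal.ofReal (c₀ / c * (Real.Gamma (((n : ℝ) - Fintype.card κ₀) / 2)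
            / Real.Gamma (((n : ℝ) - Fintype.card κ) / 2))
          * (sumSq z ^ ((Fintype.card κ₂ : ℝ) / 2)
            * (sumSq z + sumSq w) ^ (-(((Fintype.card κ₂ : ℝ) + Fintype.card κ₁) / 2))))
        * ((gramIntegral X)⁻¹ * gramIntegral X₀) := by
  have hn := e.card_eq
  have hn' : (n : ℝ) = Fintype.card κ₂ + (Fintype.card κ₁ + Fintype.card κ₀) := by
    exact_mod_cast hn
  have hcard' : (Fintype.card κ₀ : ℝ) + Fintype.card κ₁ = Fintype.card κ := by
    exact_mod_cast hcard
  have hz0 := sumSq_pos hz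
  have hw := sumSq_nonneg w
  have hne : ∀ w', e.toEquiv (z, w', 0) ≠ 0 := fun w' h => by
    rw [LinearEquiv.map_eq_zero_iff] at h
    exact hz (congrArg Prod.fst h)
  have hg := (gramIntegral_pos X).ne'
  have hg' := (gramIntegral_lt_top hX).ne
  have h1 : priorPredictive δ X (jeffreys c) (e.toEquiv (z, w, u))
      = ENNReal.ofReal (c * Real.pi ^ (-((n : ℝ) / 2))
          * Real.Gamma (((n : ℝ) - Fintype.card κ) / 2)
          * sumSq z ^ (-((Fintype.card κ₂ : ℝ) / 2))) * gramIntegral X := by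
    obtain ⟨β, -, hβ⟩ := e.exists_eq_mulVec_add z w u
    rw [hβ, priorPredictive_jeffreys (e.transpose_mulVec z) (hne 0) β hc hδ (by omega),
      e.sumSq_residual]
    congr 4
    rw [hn', ← hcard']
    ring
  have h2 : priorPredictive δ X₀ (jeffreys c₀) (e.toEquiv (z, w, u))
      = ENNReal.ofReal (c₀ * Real.pi ^ (-((n : ℝ) / 2))
          * Real.Gamma (((n : ℝ) - Fintype.card κ₀) / 2)
          * (sumSq z + sumSq w) ^ (-(((Fintype.card κ₂ : ℝ) + Fintype.card κ₁) / 2)))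
        * gramIntegral X₀ := by
    obtain ⟨β, hβ⟩ := e.exists_eq_mulVec_ref_add z w u
    rw [hβ, priorPredictive_jeffreys (e.transpose_mulVec_ref z w) (hne w) β hc₀ hδ (by omega),
      e.sumSq_residual_ref]
    congr 4
    rw [hn']
    ring
  have hΓ : 0 < Real.Gamma (((n : ℝ) - Fintype.card κ) / 2) := by
    apply Real.Gamma_pos_of_pos
    rw [hn', ← hcard']
    have : (0 : ℝ) < Fintype.card κ₂ := by exact_mod_cast hN
    linarith
  rw [h1, h2, ENNReal.mul_inv (Or.inr hg') (Or.inr hg), mul_mul_mul_comm,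
    ← ENNReal.ofReal_inv_of_pos (by positivity), ← ENNReal.ofReal_mul (by positivity)]
  congr 2
  rw [Real.rpow_neg hz0.le ((Fintype.card κ₂ : ℝ) / 2)]
  field_simp

lemma lintegral_likelihood_mul_powerLikelihood_coords {c δ : ℝ} (hc : 0 < c) (hδ : 0 < δ)
    (hcard : Fintype.card κ₀ + Fintype.card κ₁ = Fintype.card κ) (hN : 0 < Fintype.card κ₂)
    {z₀ : κ₂ → ℝ} (hz₀ : z₀ ≠ 0) (w₀ : κ₁ → ℝ) (u₀ : κ₀ → ℝ)
    (z : κ₂ → ℝ) (w : κ₁ → ℝ) (u : κ₀ → ℝ) :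
    ∫⁻ β : κ → ℝ, ∫⁻ v in Set.Ioi (0 : ℝ), likelihood X β v (e.toEquiv (z₀, w₀, u₀))
        * (powerLikelihood δ X β v (e.toEquiv (z, w, u)) * jeffreys c β v)
      = ENNReal.ofReal (c * Real.pi ^ (-(n : ℝ)) * δ ^ (-((n : ℝ) / 2))
          * (1 + δ⁻¹) ^ (-((Fintype.card κ : ℝ) / 2))
          * Real.Gamma ((n : ℝ) - (Fintype.card κ : ℝ) / 2)
          * (sumSq z₀ + sumSq z / δ + (sumSq (w - w₀) + sumSq (u - u₀)) / (1 + δ))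
            ^ (-((n : ℝ) - (Fintype.card κ : ℝ) / 2))) * gramIntegral X := by
  have hn := e.card_eq
  obtain ⟨β₁, h₁, h₁'⟩ := e.exists_eq_mulVec_add z₀ w₀ u₀
  obtain ⟨β₂, h₂, h₂'⟩ := e.exists_eq_mulVec_add z w u
  have hne : e.toEquiv (z₀, 0, 0) ≠ 0 := fun h => by
    rw [LinearEquiv.map_eq_zero_iff] at h
    exact hz₀ (congrArg Prod.fst h)
  have hsub : sumSq (X *ᵥ (β₁ - β₂)) = sumSq (w - w₀) + sumSq (u - u₀) := by
    rw [Matrix.mulVec_sub, h₁, h₂, ← map_sub, Prod.mk_sub_mk, Prod.mk_sub_mk, e.sumSq_apply]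
    simp only [sub_self, sumSq_zero, zero_add]
    rw [sumSq_sub_comm w, sumSq_sub_comm u]
  rw [h₁', h₂', lintegral_likelihood_mul_powerLikelihood (e.transpose_mulVec z₀)
    (e.transpose_mulVec z) hne β₁ β₂ hc hδ (by omega), hsub, e.sumSq_residual, e.sumSq_residual]

lemma marginalLikelihood_eq (hX₀ : LinearIndependent ℝ X₀.col)
    (hX : LinearIndependent ℝ X.col) {c₀ c δ : ℝ} (hc₀ : 0 < c₀) (hc : 0 < c) (hδ : 0 < δ)
    (hcard : Fintype.card κ₀ + Fintype.card κ₁ = Fintype.card κ) (hN : 0 < Fintype.card κ₂)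
    {z₀ : κ₂ → ℝ} (hz₀ : z₀ ≠ 0) (w₀ : κ₁ → ℝ) (u₀ : κ₀ → ℝ) :
    marginalLikelihood X (pepPrior δ X₀ (jeffreys c₀) X (jeffreys c)) (e.toEquiv (z₀, w₀, u₀))
      = gramIntegral X₀ * (ENNReal.ofReal (c₀ * Real.pi ^ (-(n : ℝ)) * δ ^ (-((n : ℝ) / 2))
          * (1 + δ⁻¹) ^ (-((Fintype.card κ : ℝ) / 2))
          * (Real.Gamma (((n : ℝ) - Fintype.card κ₀) / 2)
            / Real.Gamma (((n : ℝ) - Fintype.card κ) / 2))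
          * Real.Gamma ((n : ℝ) - (Fintype.card κ : ℝ) / 2))
        * imaginaryIntegral (κ₂ := κ₂) δ ((n : ℝ) - (Fintype.card κ : ℝ) / 2) (sumSq z₀) w₀ u₀) := by
  have hn := e.card_eq
  have hn' : (n : ℝ) = Fintype.card κ₂ + (Fintype.card κ₁ + Fintype.card κ₀) := by
    exact_mod_cast hn
  have hcard' : (Fintype.card κ₀ : ℝ) + Fintype.card κ₁ = Fintype.card κ := by
    exact_mod_cast hcard
  have hN' : (0 : ℝ) < Fintype.card κ₂ := by exact_mod_cast hN
  have hk₀ : (0 : ℝ) ≤ Fintype.card κ₀ := by positivity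
  have hk₁ : (0 : ℝ) ≤ Fintype.card κ₁ := by positivity
  have hz₀' := sumSq_pos hz₀
  have hg := (gramIntegral_pos X).ne'
  have hg' := (gramIntegral_lt_top hX).ne
  have hΓ₁ : 0 < Real.Gamma (((n : ℝ) - Fintype.card κ) / 2) :=
    Real.Gamma_pos_of_pos (by linarith)
  have hΓ₂ : 0 < Real.Gamma (((n : ℝ) - Fintype.card κ₀) / 2) :=
    Real.Gamma_pos_of_pos (by linarith)
  have hΓ₃ : 0 < Real.Gamma ((n : ℝ) - (Fintype.card κ : ℝ) / 2) :=
    Real.Gamma_pos_of_pos (by linarith)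
  set F : (κ₂ → ℝ) × (κ₁ → ℝ) × (κ₀ → ℝ) → ℝ≥0∞ := fun a =>
    ENNReal.ofReal (c₀ / c * (Real.Gamma (((n : ℝ) - Fintype.card κ₀) / 2)
            / Real.Gamma (((n : ℝ) - Fintype.card κ) / 2))
          * (sumSq a.1 ^ ((Fintype.card κ₂ : ℝ) / 2)
            * (sumSq a.1 + sumSq a.2.1) ^ (-(((Fintype.card κ₂ : ℝ) + Fintype.card κ₁) / 2))))
        * ((gramIntegral X)⁻¹ * gramIntegral X₀) with hF
  have hFm : Measurable F := by rw [hF]; fun_prop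
  rw [marginalLikelihood_pepPrior hc hδ _ (ρ := F ∘ e.measurableEquiv.symm)
    (hFm.comp e.measurableEquiv.symm.measurable)
    (fun z => ENNReal.mul_ne_top ENNReal.ofReal_ne_top
      (ENNReal.mul_ne_top (ENNReal.inv_ne_top.2 hg) (gramIntegral_lt_top hX₀).ne)) ?_]
  · rw [← e.measurePreserving_measurableEquiv.lintegral_comp_emb
      e.measurableEquiv.measurableEmbedding]
    set C : ℝ := c₀ * Real.pi ^ (-(n : ℝ)) * δ ^ (-((n : ℝ) / 2))
      * (1 + δ⁻¹) ^ (-((Fintype.card κ : ℝ) / 2))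
      * (Real.Gamma (((n : ℝ) - Fintype.card κ₀) / 2)
        / Real.Gamma (((n : ℝ) - Fintype.card κ) / 2))
      * Real.Gamma ((n : ℝ) - (Fintype.card κ : ℝ) / 2) with hC
    set G : (κ₂ → ℝ) × (κ₁ → ℝ) × (κ₀ → ℝ) → ℝ≥0∞ := fun a =>
      ENNReal.ofReal (sumSq a.1 ^ ((Fintype.card κ₂ : ℝ) / 2)
        * (sumSq a.1 + sumSq a.2.1) ^ (-(((Fintype.card κ₂ : ℝ) + Fintype.card κ₁) / 2))
        * (sumSq z₀ + sumSq a.1 / δ + (sumSq (a.2.1 - w₀) + sumSq (a.2.2 - u₀)) / (1 + δ))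
          ^ (-((n : ℝ) - (Fintype.card κ : ℝ) / 2))) with hG
    have hGm : Measurable G := by rw [hG]; fun_prop
    have hpt : ∀ a : (κ₂ → ℝ) × (κ₁ → ℝ) × (κ₀ → ℝ),
        (F ∘ e.measurableEquiv.symm) (e.measurableEquiv a)
          * ∫⁻ β : κ → ℝ, ∫⁻ v in Set.Ioi (0 : ℝ), likelihood X β v (e.toEquiv (z₀, w₀, u₀))
            * (powerLikelihood δ X β v (e.measurableEquiv a) * jeffreys c β v)
        = gramIntegral X₀ * ENNReal.ofReal C * G a := fun a => by
      obtain ⟨z, w, u⟩ := a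
      have hz := sumSq_nonneg z
      have hw := sumSq_nonneg w
      have hw' := sumSq_nonneg (w - w₀)
      have hu' := sumSq_nonneg (u - u₀)
      rw [Function.comp_apply, MeasurableEquiv.symm_apply_apply, coe_measurableEquiv,
        e.lintegral_likelihood_mul_powerLikelihood_coords hc hδ hcard hN hz₀ w₀ u₀ z w u]
      simp only [hF, hG]
      -- The Gram integral of the joint term cancels that of the predictive in the denominator; only
      -- the reference model's survives, common to all models. The constant `c` disappears in the
      -- same way.
      have hcancel : (gramIntegral X)⁻¹ * gramIntegral X₀ * gramIntegral X = gramIntegral X₀ := by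
        rw [mul_right_comm, ENNReal.inv_mul_cancel hg hg', one_mul]
      rw [mul_mul_mul_comm, hcancel, ← ENNReal.ofReal_mul (by positivity),
        mul_assoc (gramIntegral X₀), ← ENNReal.ofReal_mul (by positivity), mul_comm]
      congr 2
      rw [hC]
      field_simp
    simp_rw [hpt]
    rw [lintegral_const_mul _ hGm, mul_assoc, Measure.volume_eq_prod,
      lintegral_prod _ hGm.aemeasurable, imaginaryIntegral]
    congr 2
    refine lintegral_congr fun z => ?_
    exact lintegral_prod (fun p => G (z, p)) (by fun_prop)
  · filter_upwards [e.ae_fst_ne_zero hN] with y hy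
    have h := e.inv_priorPredictive_mul_priorPredictive hX hc₀ hc hδ hcard hN hy
      (e.measurableEquiv.symm y).2.1 (e.measurableEquiv.symm y).2.2
    rw [← coe_measurableEquiv] at h
    simp only [Prod.mk.eta, MeasurableEquiv.apply_symm_apply] at h
    exact h

end AdaptedCoords

end Marginal

/-! ### Simplified constants and explicit bounds for the marginal likelihood -/

/-- The factor of the marginal likelihoods that only depends on the reference model. -/
noncomputable def refConst (n k₀ c₀ δ : ℝ) : ℝ :=
  c₀ * Real.pi ^ (-(n / 2)) * Real.Gamma ((n - k₀) / 2) * (1 + δ) ^ (k₀ / 2)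

/-- The Gamma factors telescope and the powers of `π` and `δ` combine, so that `k` survives only in
`(1 + δ) ^ (-(k / 2))`: the source of the dimension penalty. -/
lemma marginalConst_mul_imaginaryConst {n k k₀ q N c₀ δ : ℝ} (hn : n = N + (q + k₀))
    (hk : k₀ + q = k) (hk₀ : 0 ≤ k₀) (hq : 0 ≤ q) (hN : 0 < N) (hδ : 0 < δ) :
    c₀ * Real.pi ^ (-n) * δ ^ (-(n / 2)) * (1 + δ⁻¹) ^ (-(k / 2))
        * (Real.Gamma ((n - k₀) / 2) / Real.Gamma ((n - k) / 2)) * Real.Gamma (n - k / 2)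
        * imaginaryConst k₀ q N δ (n - k / 2)
      = refConst n k₀ c₀ δ * (1 + δ) ^ (-(k / 2)) := by
  have hπ := Real.pi_pos
  have hδ' : 0 < 1 + δ := by positivity
  have a1 : (n - k₀) / 2 = (N + q) / 2 := by rw [hn]; ring
  have a2 : (n - k) / 2 = N / 2 := by rw [hn, ← hk]; ring
  have a3 : (N + q) / 2 - q / 2 = N / 2 := by ring
  have a4 : n - k / 2 - k₀ / 2 - N / 2 = (N + q) / 2 := by rw [hn, ← hk]; ring
  have g1 := Real.Gamma_pos_of_pos (show 0 < N / 2 by positivity)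
  have g2 := Real.Gamma_pos_of_pos (show 0 < (N + q) / 2 by positivity)
  have g3 := Real.Gamma_pos_of_pos (show 0 < n - k / 2 by linarith)
  have g4 := Real.Gamma_pos_of_pos (show 0 < n - k / 2 - k₀ / 2 by linarith)
  have p1 : Real.pi ^ (-n) * Real.pi ^ (k₀ / 2) * Real.pi ^ (q / 2) * Real.pi ^ (N / 2)
      = Real.pi ^ (-(n / 2)) := by
    rw [← Real.rpow_add hπ, ← Real.rpow_add hπ, ← Real.rpow_add hπ]
    congr 1
    linarith
  have p2 : δ ^ (-(n / 2)) * δ ^ (N / 2) * δ ^ (k / 2) = 1 := by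
    rw [← Real.rpow_add hδ, ← Real.rpow_add hδ, ← Real.rpow_zero δ]
    congr 1
    linarith
  have p3 : (1 + δ⁻¹) ^ (-(k / 2)) = (1 + δ) ^ (-(k / 2)) * δ ^ (k / 2) := by
    rw [show 1 + δ⁻¹ = (1 + δ) / δ by field_simp; ring, Real.div_rpow hδ'.le hδ.le,
      Real.rpow_neg hδ.le, div_inv_eq_mul]
  rw [imaginaryConst, studentConst, studentConst, studentConst, refConst, a1, a2, a3, a4, p3,
    div_inv_eq_mul, div_inv_eq_mul, div_one, Real.mul_rpow hπ.le hδ'.le, Real.mul_rpow hπ.le hδ.le]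
  calc _ = c₀ * (Real.pi ^ (-n) * Real.pi ^ (k₀ / 2) * Real.pi ^ (q / 2) * Real.pi ^ (N / 2))
        * (δ ^ (-(n / 2)) * δ ^ (N / 2) * δ ^ (k / 2)) * Real.Gamma ((N + q) / 2)
        * (1 + δ) ^ (k₀ / 2) * (1 + δ) ^ (-(k / 2)) := by
        generalize Real.Gamma (n - k / 2) = Γ₃ at *
        generalize Real.Gamma (n - k / 2 - k₀ / 2) = Γ₄ at *
        field_simp
    _ = _ := by rw [p1, p2]; ring

lemma exp_neg_mul_le_one_add_rpow_neg {x a : ℝ} (hx : 0 ≤ x) (ha : 0 ≤ a) :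
    Real.exp (-(a * x)) ≤ (1 + x) ^ (-a) := by
  rw [Real.rpow_def_of_pos (by positivity), Real.exp_le_exp]
  have h := Real.log_le_sub_one_of_pos (show 0 < 1 + x by positivity)
  nlinarith

section Bounds

variable {n : ℕ} {κ₀ κ κ₁ κ₂ : Type*} [Fintype κ₀] [Fintype κ] [Fintype κ₁] [Fintype κ₂]
  {X₀ : Matrix (Fin n) κ₀ ℝ} {X : Matrix (Fin n) κ ℝ}

namespace AdaptedCoords

variable (e : AdaptedCoords X₀ X κ₁ κ₂)

include e in
lemma cast_card_eq : (n : ℝ) = Fintype.card κ₂ + (Fintype.card κ₁ + Fintype.card κ₀) := by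
  exact_mod_cast e.card_eq

lemma marginalLikelihood_le (hX₀ : LinearIndependent ℝ X₀.col)
    (hX : LinearIndependent ℝ X.col) {c₀ c δ : ℝ} (hc₀ : 0 < c₀) (hc : 0 < c) (hδ : 0 < δ)
    (hcard : Fintype.card κ₀ + Fintype.card κ₁ = Fintype.card κ) (hN : 0 < Fintype.card κ₂)
    {z₀ : κ₂ → ℝ} (hz₀ : z₀ ≠ 0) (w₀ : κ₁ → ℝ) (u₀ : κ₀ → ℝ) :
    marginalLikelihood X (pepPrior δ X₀ (jeffreys c₀) X (jeffreys c)) (e.toEquiv (z₀, w₀, u₀))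
      ≤ gramIntegral X₀ * ENNReal.ofReal (refConst n (Fintype.card κ₀) c₀ δ
        * (1 + δ) ^ (-((Fintype.card κ : ℝ) / 2))
        * sumSq z₀ ^ (-(((n : ℝ) - Fintype.card κ₀) / 2))) := by
  have hn := e.cast_card_eq
  have hcard' : (Fintype.card κ₀ : ℝ) + Fintype.card κ₁ = Fintype.card κ := by
    exact_mod_cast hcard
  have hN' : (0 : ℝ) < Fintype.card κ₂ := by exact_mod_cast hN
  have hk₀ : (0 : ℝ) ≤ Fintype.card κ₀ := by positivity
  have hk₁ : (0 : ℝ) ≤ Fintype.card κ₁ := by positivity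
  have hΓ₁ := Real.Gamma_pos_of_pos (show 0 < ((n : ℝ) - Fintype.card κ) / 2 by linarith)
  have hΓ₂ := Real.Gamma_pos_of_pos (show 0 < ((n : ℝ) - Fintype.card κ₀) / 2 by linarith)
  have hΓ₃ := Real.Gamma_pos_of_pos (show 0 < (n : ℝ) - (Fintype.card κ : ℝ) / 2 by linarith)
  rw [e.marginalLikelihood_eq hX₀ hX hc₀ hc hδ hcard hN hz₀]
  gcongr
  refine (mul_le_mul_right (imaginaryIntegral_le w₀ u₀ hδ (sumSq_pos hz₀) hN
    (by linarith)) _).trans (le_of_eq ?_)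
  rw [← ENNReal.ofReal_mul (by positivity), ← mul_assoc,
    marginalConst_mul_imaginaryConst hn hcard' hk₀ hk₁ hN' hδ]
  congr 3
  linarith

lemma le_marginalLikelihood (hX₀ : LinearIndependent ℝ X₀.col)
    (hX : LinearIndependent ℝ X.col) {c₀ c δ : ℝ} (hc₀ : 0 < c₀) (hc : 0 < c) (hδ : (n : ℝ) ≤ δ)
    (hcard : Fintype.card κ₀ + Fintype.card κ₁ = Fintype.card κ) (hN : 3 ≤ Fintype.card κ₂)
    {z₀ : κ₂ → ℝ} (hz₀ : z₀ ≠ 0) (w₀ : κ₁ → ℝ) (u₀ : κ₀ → ℝ) :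
    gramIntegral X₀ * ENNReal.ofReal (refConst n (Fintype.card κ₀) c₀ δ
        * (1 + δ) ^ (-((Fintype.card κ : ℝ) / 2))
        * sumSq z₀ ^ (-(((n : ℝ) - Fintype.card κ₀) / 2))
        * Real.exp (-(3 * Fintype.card κ₁ + sumSq w₀ / sumSq z₀)))
      ≤ marginalLikelihood X (pepPrior δ X₀ (jeffreys c₀) X (jeffreys c))
        (e.toEquiv (z₀, w₀, u₀)) := by
  have hn := e.cast_card_eq
  have hcard' : (Fintype.card κ₀ : ℝ) + Fintype.card κ₁ = Fintype.card κ := by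
    exact_mod_cast hcard
  have hN' : (3 : ℝ) ≤ Fintype.card κ₂ := by exact_mod_cast hN
  have hk₀ : (0 : ℝ) ≤ Fintype.card κ₀ := by positivity
  have hk₁ : (0 : ℝ) ≤ Fintype.card κ₁ := by positivity
  have hδ0 : 0 < δ := by linarith
  have hA := sumSq_pos hz₀
  have hB := sumSq_nonneg w₀
  have hΓ₁ := Real.Gamma_pos_of_pos (show 0 < ((n : ℝ) - Fintype.card κ) / 2 by linarith)
  have hΓ₂ := Real.Gamma_pos_of_pos (show 0 < ((n : ℝ) - Fintype.card κ₀) / 2 by linarith)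
  have hΓ₃ := Real.Gamma_pos_of_pos (show 0 < (n : ℝ) - (Fintype.card κ : ℝ) / 2 by linarith)
  rw [e.marginalLikelihood_eq hX₀ hX hc₀ hc hδ0 hcard (by omega) hz₀]
  gcongr
  refine le_trans ?_ (mul_le_mul_right (le_imaginaryIntegral w₀ u₀ hδ0 hA (by omega)
    (by linarith)) _)
  rw [← ENNReal.ofReal_mul (by positivity), ← mul_assoc, ← mul_assoc,
    marginalConst_mul_imaginaryConst hn hcard' hk₀ hk₁ (by linarith) hδ0]
  refine ENNReal.ofReal_le_ofReal ?_
  have hr : 0 < refConst n (Fintype.card κ₀) c₀ δ := by unfold refConst; positivity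
  rw [mul_assoc, mul_assoc, mul_assoc, mul_assoc (refConst _ _ _ _)]
  refine mul_le_mul_of_nonneg_left (mul_le_mul_of_nonneg_left ?_ (by positivity)) hr.le
  have hM : (n : ℝ) - (Fintype.card κ : ℝ) / 2 - (Fintype.card κ₀ : ℝ) / 2
      - (Fintype.card κ₂ : ℝ) / 2 = ((n : ℝ) - Fintype.card κ₀) / 2 := by linarith
  have hM0 : 0 ≤ ((n : ℝ) - Fintype.card κ₀) / 2 := by linarith
  have hsplit : sumSq z₀ + 2 * sumSq w₀ / (1 + δ)
      = sumSq z₀ * (1 + 2 * sumSq w₀ / (sumSq z₀ * (1 + δ))) := by field_simp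
  have hN2 : (0 : ℝ) < Fintype.card κ₂ - 2 := by linarith
  -- The constant `3` bounds `N / (N - 2)` for `N ≥ 3`, where `N` is the cardinality of `κ₂`.
  have h1 : Real.exp (-(3 * Fintype.card κ₁))
      ≤ (1 + 2 * (Fintype.card κ₁ : ℝ) / (Fintype.card κ₂ - 2))
          ^ (-((Fintype.card κ₂ : ℝ) / 2)) := by
    refine le_trans ?_ (exp_neg_mul_le_one_add_rpow_neg (by positivity) (by positivity))
    rw [Real.exp_le_exp, neg_le_neg_iff]
    have : (Fintype.card κ₂ : ℝ) / 2 * (2 * (Fintype.card κ₁ : ℝ) / (Fintype.card κ₂ - 2))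
        = Fintype.card κ₁ * Fintype.card κ₂ / (Fintype.card κ₂ - 2) := by ring
    rw [this, div_le_iff₀ hN2]
    nlinarith
  -- Since `δ ≥ n`, the factor `1 + δ` absorbs the exponent `n - k₀`, which keeps the loss bounded
  -- in `n`.
  have h2 : Real.exp (-(sumSq w₀ / sumSq z₀))
      ≤ (1 + 2 * sumSq w₀ / (sumSq z₀ * (1 + δ))) ^ (-(((n : ℝ) - Fintype.card κ₀) / 2)) := by
    refine le_trans ?_ (exp_neg_mul_le_one_add_rpow_neg (by positivity) hM0)
    rw [Real.exp_le_exp, neg_le_neg_iff]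
    have : ((n : ℝ) - Fintype.card κ₀) / 2 * (2 * sumSq w₀ / (sumSq z₀ * (1 + δ)))
        = sumSq w₀ / sumSq z₀ * (((n : ℝ) - Fintype.card κ₀) / (1 + δ)) := by field_simp
    rw [this]
    refine mul_le_of_le_one_right (by positivity) ?_
    rw [div_le_one (by positivity)]
    linarith
  rw [hM, hsplit, Real.mul_rpow hA.le (by positivity), neg_add, Real.exp_add]
  rw [mul_left_comm (_ ^ (-((Fintype.card κ₂ : ℝ) / 2)))]
  exact mul_le_mul_of_nonneg_left (mul_le_mul h1 h2 (by positivity) (by positivity))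
    (by positivity)

end AdaptedCoords

end Bounds

/-! ### Residual sums of squares, BIC and the Bayes factor -/

section ModelSelection

variable {n : ℕ} {ι : Type*}

lemma linearIndependent_design_of_subset {X : Matrix (Fin n) ι ℝ} {S₀ S : Finset ι} (h : S₀ ⊆ S)
    (hX : LinearIndependent ℝ (design X S).col) : LinearIndependent ℝ (design X S₀).col :=
  hX.comp (fun j : S₀ => (⟨j, h j.2⟩ : S)) fun _ _ hij =>
    Subtype.ext (congrArg (fun k : S => (k : ι)) hij)

lemma exists_design_mulVec_eq_of_subset (X : Matrix (Fin n) ι ℝ) {S₀ S : Finset ι} (h : S₀ ⊆ S)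
    (β₀ : S₀ → ℝ) : ∃ β, design X S *ᵥ β = design X S₀ *ᵥ β₀ := by
  classical
  set b : ι → ℝ := fun j => if hj : j ∈ S₀ then β₀ ⟨j, hj⟩ else 0 with hb
  have hb0 : ∀ j : S₀, b j = β₀ j := fun j => by simp [hb]
  refine ⟨fun j => b j, funext fun i => ?_⟩
  simp only [Matrix.mulVec, dotProduct, design, Matrix.submatrix_apply, id]
  rw [Finset.sum_coe_sort S fun j => X i j * b j]
  simp_rw [← hb0]
  rw [Finset.sum_coe_sort S₀ fun j => X i j * b j]
  exact (Finset.sum_subset h fun j _ hj => by simp [hb, hj]).symm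

lemma isUnit_det_transpose_mul_self {κ : Type*} [Fintype κ] [DecidableEq κ]
    {X : Matrix (Fin n) κ ℝ} (hX : LinearIndependent ℝ X.col) : IsUnit (Xᵀ * X).det := by
  have h := Matrix.PosDef.conjTranspose_mul_self X (Matrix.mulVec_injective_iff.2 hX)
  rw [Matrix.conjTranspose_eq_transpose_of_trivial] at h
  exact h.det_pos.ne'.isUnit

lemma rss_eq_sumSq [DecidableEq ι] {X : Matrix (Fin n) ι ℝ} {S : Finset ι}
    (hX : LinearIndependent ℝ (design X S).col) {r : Fin n → ℝ}
    (hr : (design X S)ᵀ *ᵥ r = 0) (β : S → ℝ) :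
    rss X (design X S *ᵥ β + r) S = sumSq r := by
  have h1 : (1 - design X S * ((design X S)ᵀ * design X S)⁻¹ * (design X S)ᵀ)
      *ᵥ (design X S *ᵥ β + r) = r := by
    rw [Matrix.sub_mulVec, Matrix.one_mulVec, ← Matrix.mulVec_mulVec, Matrix.mulVec_add, hr,
      add_zero, Matrix.mulVec_mulVec, Matrix.mulVec_mulVec, Matrix.mul_assoc, Matrix.mul_assoc,
      Matrix.nonsing_inv_mul _ (isUnit_det_transpose_mul_self hX), Matrix.mul_one,
      add_sub_cancel_left]
  rw [rss, h1, add_dotProduct, sumSq_eq_dotProduct, dotProduct_comm _ r, Matrix.dotProduct_mulVec,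
    ← Matrix.mulVec_transpose, hr, zero_dotProduct, zero_add]

lemma exists_eq_mulVec_add_of_linearIndependent {κ : Type*} [Fintype κ] {X : Matrix (Fin n) κ ℝ}
    (hX : LinearIndependent ℝ X.col) (y : Fin n → ℝ) :
    ∃ β r, y = X *ᵥ β + r ∧ Xᵀ *ᵥ r = 0 := by
  classical
  refine ⟨(Xᵀ * X)⁻¹ *ᵥ (Xᵀ *ᵥ y), y - X *ᵥ ((Xᵀ * X)⁻¹ *ᵥ (Xᵀ *ᵥ y)), by abel, ?_⟩
  rw [Matrix.mulVec_sub, Matrix.mulVec_mulVec _ Xᵀ X, Matrix.mulVec_mulVec _ (Xᵀ * X),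
    Matrix.mul_nonsing_inv _ (isUnit_det_transpose_mul_self hX), Matrix.one_mulVec, sub_self]

/-- The maximum over the variance is at `v = R / n`. In terms of `x = R / (n v)` the claim is `log x
≤ x - 1`. -/
lemma normalDensity_le_of_sumSq_le {μ y : Fin n → ℝ} {R v : ℝ} (hn : 0 < n) (hR : 0 < R)
    (hv : 0 < v) (h : R ≤ sumSq (y - μ)) :
    normalDensity μ v y
      ≤ (2 * Real.pi * (R / n)) ^ (-((n : ℝ) / 2)) * Real.exp (-((n : ℝ) / 2)) := by
  have hn' : (0 : ℝ) < n := by exact_mod_cast hn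
  set x : ℝ := R / (n * v) with hx
  have hx0 : 0 < x := by positivity
  have hvx : 2 * Real.pi * v = 2 * Real.pi * (R / n) / x := by rw [hx]; field_simp
  have hlog := mul_le_mul_of_nonneg_right (Real.log_le_sub_one_of_pos hx0)
    (show (0 : ℝ) ≤ n / 2 by positivity)
  have hRx : (2 * v)⁻¹ * R = x * (n / 2) := by rw [hx]; field_simp
  rw [normalDensity_eq, hvx, Real.div_rpow (by positivity) hx0.le, Real.rpow_neg hx0.le,
    div_inv_eq_mul, mul_assoc]
  refine mul_le_mul_of_nonneg_left ?_ (by positivity)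
  rw [Real.rpow_def_of_pos hx0, ← Real.exp_add, Real.exp_le_exp]
  have h2 : (2 * v)⁻¹ * R ≤ (2 * v)⁻¹ * sumSq (y - μ) := by gcongr
  linarith

lemma sSup_normalDensity {κ : Type*} [Fintype κ] {X : Matrix (Fin n) κ ℝ} {r : Fin n → ℝ}
    (hn : 0 < n) (hr : Xᵀ *ᵥ r = 0) (hr0 : r ≠ 0) (β₀ : κ → ℝ) :
    sSup {L : ℝ | ∃ (β : κ → ℝ) (v : ℝ), 0 < v ∧ L = normalDensity (X *ᵥ β) v (X *ᵥ β₀ + r)}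
      = (2 * Real.pi * (sumSq r / n)) ^ (-((n : ℝ) / 2)) * Real.exp (-((n : ℝ) / 2)) := by
  have hn' : (0 : ℝ) < n := by exact_mod_cast hn
  have hR := sumSq_pos hr0
  refine IsGreatest.csSup_eq ⟨⟨β₀, sumSq r / n, by positivity, ?_⟩, ?_⟩
  · rw [normalDensity_eq, add_sub_cancel_left]
    congr 3
    field_simp
  · rintro L ⟨β, v, hv, rfl⟩
    refine normalDensity_le_of_sumSq_le hn hR hv ?_
    rw [sumSq_sub_mulVec hr]
    have := sumSq_nonneg (X *ᵥ (β - β₀))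
    linarith

lemma bic_eq [DecidableEq ι] {X : Matrix (Fin n) ι ℝ} {y : Fin n → ℝ} {S : Finset ι} (hn : 0 < n)
    (hX : LinearIndependent ℝ (design X S).col) (hR : 0 < rss X y S) :
    bic X y S = n * Real.log (2 * Real.pi * (rss X y S / n)) + n
      + ((S.card : ℝ) + 1) * Real.log n := by
  have hn' : (0 : ℝ) < n := by exact_mod_cast hn
  obtain ⟨β, r, rfl, hr⟩ := exists_eq_mulVec_add_of_linearIndependent hX y
  rw [rss_eq_sumSq hX hr] at hR ⊢
  have hr0 : r ≠ 0 := fun h => by simp [h] at hR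
  rw [bic, sSup_normalDensity hn hr hr0, Real.log_mul (by positivity) (Real.exp_pos _).ne',
    Real.log_exp, Real.log_rpow (by positivity)]
  ring

lemma bic_sub_bic [DecidableEq ι] {X : Matrix (Fin n) ι ℝ} {y : Fin n → ℝ} {S T : Finset ι}
    (hn : 0 < n) (hXS : LinearIndependent ℝ (design X S).col)
    (hXT : LinearIndependent ℝ (design X T).col) (hRS : 0 < rss X y S) (hRT : 0 < rss X y T) :
    n * Real.log (rss X y S / rss X y T) + ((S.card : ℝ) - (T.card : ℝ)) * Real.log n
      = bic X y S - bic X y T := by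
  have hn' : (0 : ℝ) < n := by exact_mod_cast hn
  have hπ := Real.pi_pos
  rw [bic_eq hn hXS hRS, bic_eq hn hXT hRT, Real.log_div hRS.ne' hRT.ne',
    Real.log_mul (y := rss X y S / n) (by positivity) (by positivity),
    Real.log_mul (y := rss X y T / n) (by positivity) (by positivity),
    Real.log_div hRS.ne' hn'.ne', Real.log_div hRT.ne' hn'.ne']
  ring

/-- The approximation of `jpepMarginal` up to a bounded factor, apart from the factor
`gramIntegral (design X S₀)`. -/
noncomputable def marginalApprox [DecidableEq ι] (X : Matrix (Fin n) ι ℝ) (y : Fin n → ℝ)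
    (c : Finset ι → ℝ) (S₀ S : Finset ι) : ℝ :=
  refConst n S₀.card (c S₀) n * (1 + (n : ℝ)) ^ (-((S.card : ℝ) / 2))
    * rss X y S ^ (-(((n : ℝ) - S₀.card) / 2))

lemma jpepMarginal_bounds [DecidableEq ι] {X : Matrix (Fin n) ι ℝ} {y : Fin n → ℝ}
    {c : Finset ι → ℝ} (hc : ∀ S, 0 < c S) {S₀ S : Finset ι} (h : S₀ ⊆ S)
    (hX : LinearIndependent ℝ (design X S).col) (hn : S.card + 3 ≤ n) {ε : ℝ} (hε : 0 < ε)
    (hR : ε ≤ rss X y S / rss X y S₀) :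
    0 < rss X y S ∧ rss X y S ≤ rss X y S₀ ∧
      jpepMarginal X y c S₀ S
        ≤ gramIntegral (design X S₀) * ENNReal.ofReal (marginalApprox X y c S₀ S) ∧
      gramIntegral (design X S₀) * ENNReal.ofReal (marginalApprox X y c S₀ S
        * Real.exp (-(3 * S.card + 1 / ε))) ≤ jpepMarginal X y c S₀ S := by
  have hX₀ := linearIndependent_design_of_subset h hX
  have hle := Finset.card_le_card h
  obtain ⟨e⟩ := exists_adaptedCoords (κ₁ := Fin (S.card - S₀.card)) (κ₂ := Fin (n - S.card))
    hX₀ hX (exists_design_mulVec_eq_of_subset X h) (by simp; omega) (by simp; omega)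
  obtain ⟨⟨z, w, u⟩, rfl⟩ := e.toEquiv.surjective y
  have hRS : rss X (e.toEquiv (z, w, u)) S = sumSq z := by
    obtain ⟨β, -, hβ⟩ := e.exists_eq_mulVec_add z w u
    rw [hβ, rss_eq_sumSq hX (e.transpose_mulVec z), e.sumSq_residual]
  have hRS₀ : rss X (e.toEquiv (z, w, u)) S₀ = sumSq z + sumSq w := by
    obtain ⟨β, hβ⟩ := e.exists_eq_mulVec_ref_add z w u
    rw [hβ, rss_eq_sumSq hX₀ (e.transpose_mulVec_ref z w), e.sumSq_residual_ref]
  -- A zero residual sum would make the ratio `0`, whatever the denominator, against `ε > 0`.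
  have hz0 : z ≠ 0 := by
    rintro rfl
    rw [hRS, sumSq_zero, zero_div] at hR
    linarith
  have hz := sumSq_pos hz0
  have hw := sumSq_nonneg w
  have hn0 : (0 : ℝ) < n := by exact_mod_cast (show 0 < n by omega)
  have hup := e.marginalLikelihood_le hX₀ hX (hc S₀) (hc S) hn0 (by simp; omega) (by simp; omega)
    hz0 w u
  have hlow := e.le_marginalLikelihood hX₀ hX (hc S₀) (hc S) le_rfl (by simp; omega)
    (by simp; omega) hz0 w u
  simp only [Fintype.card_coe] at hup hlow
  rw [← hRS] at hz
  refine ⟨hz, by rw [hRS, hRS₀]; linarith, ?_, ?_⟩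
  · rw [marginalApprox, hRS]
    exact hup
  · refine le_trans ?_ hlow
    rw [marginalApprox, hRS]
    rw [hRS] at hz
    have hd : (S₀.card : ℝ) + 3 ≤ n := by exact_mod_cast (show S₀.card + 3 ≤ n by omega)
    have hΓ := Real.Gamma_pos_of_pos (show 0 < ((n : ℝ) - S₀.card) / 2 by linarith)
    have hc₀ := hc S₀
    have hr : 0 < refConst n S₀.card (c S₀) n := by unfold refConst; positivity
    have hq : ((Fintype.card (Fin (S.card - S₀.card)) : ℕ) : ℝ) ≤ S.card := by simp
    -- The hypothesis reads `ε * (sumSq z + sumSq w) ≤ sumSq z`.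
    have hwz : sumSq w / sumSq z ≤ 1 / ε := by
      rw [hRS, hRS₀, le_div_iff₀ (by positivity)] at hR
      rw [div_le_div_iff₀ hz hε]
      nlinarith
    exact mul_le_mul_right (ENNReal.ofReal_le_ofReal (mul_le_mul_of_nonneg_left
      (Real.exp_le_exp.2 (neg_le_neg (by linarith))) (by positivity))) _

lemma jpepMarginal_pos_lt_top_and_log [DecidableEq ι] {X : Matrix (Fin n) ι ℝ} {y : Fin n → ℝ}
    {c : Finset ι → ℝ} (hc : ∀ S, 0 < c S) {S₀ S : Finset ι} (h : S₀ ⊆ S)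
    (hX : LinearIndependent ℝ (design X S).col) (hn : S.card + 3 ≤ n) {ε : ℝ} (hε : 0 < ε)
    (hR : ε ≤ rss X y S / rss X y S₀) :
    0 < jpepMarginal X y c S₀ S ∧ jpepMarginal X y c S₀ S < ⊤ ∧
      |Real.log (jpepMarginal X y c S₀ S).toReal
        - (Real.log ((gramIntegral (design X S₀)).toReal * refConst n S₀.card (c S₀) n)
          - (S.card : ℝ) / 2 * Real.log (1 + n)
          - ((n : ℝ) - S₀.card) / 2 * Real.log (rss X y S))| ≤ 3 * S.card + 1 / ε := by
  obtain ⟨hR0, -, hup, hlow⟩ := jpepMarginal_bounds hc h hX hn hε hR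
  have hle := Finset.card_le_card h
  have hg := gramIntegral_pos (design X S₀)
  have hg' := gramIntegral_lt_top (linearIndependent_design_of_subset h hX)
  have hd : (S₀.card : ℝ) + 3 ≤ n := by exact_mod_cast (show S₀.card + 3 ≤ n by omega)
  have hΓ := Real.Gamma_pos_of_pos (show 0 < ((n : ℝ) - S₀.card) / 2 by linarith)
  have hc₀ := hc S₀
  have hr : 0 < refConst n S₀.card (c S₀) n := by unfold refConst; positivity
  have hM : 0 < marginalApprox X y c S₀ S := by unfold marginalApprox; positivity
  have htop : jpepMarginal X y c S₀ S < ⊤ :=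
    hup.trans_lt (ENNReal.mul_lt_top hg' ENNReal.ofReal_lt_top)
  have hpos : 0 < jpepMarginal X y c S₀ S :=
    (ENNReal.mul_pos hg.ne' (ENNReal.ofReal_pos.2 (by positivity)).ne').trans_le hlow
  refine ⟨hpos, htop, ?_⟩
  have hgR := ENNReal.toReal_pos hg.ne' hg'.ne
  have hup' := ENNReal.toReal_mono (ENNReal.mul_lt_top hg' ENNReal.ofReal_lt_top).ne hup
  have hlow' := ENNReal.toReal_mono htop.ne hlow
  rw [ENNReal.toReal_mul, ENNReal.toReal_ofReal (by positivity)] at hup' hlow'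
  have hlogup := Real.log_le_log (ENNReal.toReal_pos hpos.ne' htop.ne) hup'
  have hloglow := Real.log_le_log (by positivity) hlow'
  rw [← mul_assoc, Real.log_mul (by positivity) (Real.exp_pos _).ne', Real.log_exp] at hloglow
  have hlogM : Real.log ((gramIntegral (design X S₀)).toReal * marginalApprox X y c S₀ S)
      = Real.log ((gramIntegral (design X S₀)).toReal * refConst n S₀.card (c S₀) n)
          - (S.card : ℝ) / 2 * Real.log (1 + n)
          - ((n : ℝ) - S₀.card) / 2 * Real.log (rss X y S) := by
    rw [marginalApprox, ← mul_assoc, ← mul_assoc, Real.log_mul (by positivity) (by positivity),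
      Real.log_mul (by positivity) (by positivity), Real.log_rpow (by positivity),
      Real.log_rpow hR0]
    ring
  rw [hlogM] at hlogup hloglow
  have : (0 : ℝ) ≤ 3 * S.card + 1 / ε := by positivity
  rw [abs_le]
  constructor <;> linarith

lemma abs_log_jpepBF_sub_le [DecidableEq ι] {X : Matrix (Fin n) ι ℝ} {y : Fin n → ℝ}
    {c : Finset ι → ℝ} (hc : ∀ S, 0 < c S) {S₀ S T : Finset ι} (hS : S₀ ⊆ S) (hT : S₀ ⊆ T)
    (hXS : LinearIndependent ℝ (design X S).col) (hXT : LinearIndependent ℝ (design X T).col)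
    (hnS : S.card + 3 ≤ n) (hnT : T.card + 3 ≤ n) {ε : ℝ} (hε : 0 < ε)
    (hRS : ε ≤ rss X y S / rss X y S₀) (hRT : ε ≤ rss X y T / rss X y S₀) :
    |-2 * Real.log (jpepBF X y c S₀ S T)
        - (n * Real.log (rss X y S / rss X y T)
            + ((S.card : ℝ) - (T.card : ℝ)) * Real.log n)|
      ≤ 2 * (3 * S.card + 1 / ε) + 2 * (3 * T.card + 1 / ε) + |(S.card : ℝ) - T.card|
        + S₀.card * |Real.log ε| := by
  obtain ⟨pS, tS, lS⟩ := jpepMarginal_pos_lt_top_and_log hc hS hXS hnS hε hRS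
  obtain ⟨pT, tT, lT⟩ := jpepMarginal_pos_lt_top_and_log hc hT hXT hnT hε hRT
  obtain ⟨rS, rS', -⟩ := jpepMarginal_bounds hc hS hXS hnS hε hRS
  obtain ⟨rT, rT', -⟩ := jpepMarginal_bounds hc hT hXT hnT hε hRT
  have r₀ : 0 < rss X y S₀ := rS.trans_le rS'
  have hBF : Real.log (jpepBF X y c S₀ S T)
      = Real.log (jpepMarginal X y c S₀ S).toReal - Real.log (jpepMarginal X y c S₀ T).toReal := by
    rw [jpepBF, ENNReal.toReal_div, Real.log_div (ENNReal.toReal_pos pS.ne' tS.ne).ne'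
      (ENNReal.toReal_pos pT.ne' tT.ne).ne']
  have hn0 : (1 : ℝ) ≤ n := by exact_mod_cast (show 1 ≤ n by omega)
  have hlogn : |Real.log (1 + n) - Real.log n| ≤ 1 := by
    have h1 : Real.log n ≤ Real.log (1 + n) := Real.log_le_log (by linarith) (by linarith)
    have h2 : Real.log (1 + n) - Real.log n ≤ 1 := by
      rw [← Real.log_div (by positivity) (by positivity)]
      refine (Real.log_le_sub_one_of_pos (by positivity)).trans ?_
      rw [add_div, div_self (by positivity), add_sub_cancel_right, div_le_one (by positivity)]
      exact hn0
    rw [abs_le]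
    constructor <;> linarith
  -- Both residual sums lie between `ε` times that of `S₀` and that of `S₀` itself.
  have hratio : |Real.log (rss X y S) - Real.log (rss X y T)| ≤ |Real.log ε| := by
    have a1 : Real.log (rss X y S) ≤ Real.log (rss X y S₀) := Real.log_le_log rS rS'
    have a2 : Real.log (rss X y T) ≤ Real.log (rss X y S₀) := Real.log_le_log rT rT'
    have a3 := Real.log_le_log hε hRS
    have a4 := Real.log_le_log hε hRT
    rw [Real.log_div rS.ne' r₀.ne'] at a3
    rw [Real.log_div rT.ne' r₀.ne'] at a4
    refine le_trans ?_ (neg_le_abs _)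
    rw [abs_le]
    constructor <;> linarith
  set mS := Real.log (jpepMarginal X y c S₀ S).toReal
  set mT := Real.log (jpepMarginal X y c S₀ T).toReal
  set K := Real.log ((gramIntegral (design X S₀)).toReal * refConst n S₀.card (c S₀) n)
  set LS := Real.log (rss X y S) with hLS
  set LT := Real.log (rss X y T) with hLT
  set eS := mS - (K - (S.card : ℝ) / 2 * Real.log (1 + n) - ((n : ℝ) - S₀.card) / 2 * LS) with heS
  set eT := mT - (K - (T.card : ℝ) / 2 * Real.log (1 + n) - ((n : ℝ) - S₀.card) / 2 * LT) with heT
  -- The common term `K` cancels. The last two terms replace `log (1 + n)` by `log n` and the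
  -- exponent `n - S₀.card` by `n`.
  have key : -2 * Real.log (jpepBF X y c S₀ S T)
        - (n * Real.log (rss X y S / rss X y T)
            + ((S.card : ℝ) - (T.card : ℝ)) * Real.log n)
      = -2 * eS + 2 * eT + ((S.card : ℝ) - T.card) * (Real.log (1 + n) - Real.log n)
        - S₀.card * (LS - LT) := by
    rw [hBF, Real.log_div rS.ne' rT.ne', heS, heT, hLS, hLT]
    ring
  rw [key]
  calc _ ≤ |-2 * eS| + |2 * eT| + |((S.card : ℝ) - T.card) * (Real.log (1 + n) - Real.log n)|
        + |S₀.card * (LS - LT)| :=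
        (abs_sub _ _).trans (add_le_add_left ((abs_add_le _ _).trans
          (add_le_add_left (abs_add_le _ _) _)) _)
    _ ≤ _ := by
        rw [abs_mul, abs_mul, abs_mul, abs_mul, abs_neg, abs_two, Nat.abs_cast]
        gcongr
        exact mul_le_of_le_one_right (abs_nonneg _) hlogn

end ModelSelection

/-- A bounded error is negligible against a quantity whose absolute value diverges. -/
lemma isEquivalent_of_sub_isBigO_one {α : Type*} {l : Filter α} {f g : α → ℝ}
    (h : (fun x => f x - g x) =O[l] fun _ => (1 : ℝ)) (hg : Tendsto (fun x => |g x|) l atTop) :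
    f ~[l] g :=
  h.trans_isLittleO ((isLittleO_one_left_iff ℝ).2 hg)

end JPEP

/-! ### The asymptotic statement -/

theorem theorem1 {ι : Type*} [Fintype ι] [DecidableEq ι]
    -- for every sample size `n`: the full design matrix and the response vector
    (X : ∀ n : ℕ, Matrix (Fin n) ι ℝ) (y : ∀ n : ℕ, Fin n → ℝ)
    -- arbitrary positive constants of the Jeffreys priors
    (c : Finset ι → ℝ) (hc : ∀ S, 0 < c S)
    -- the reference model, strictly nested in the two models to be compared
    (S₀ Sl Sk : Finset ι) (hl : S₀ ⊂ Sl) (hk : S₀ ⊂ Sk)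
    -- the design matrices of the two models have full column rank
    (hXl : ∀ᶠ n in atTop, LinearIndependent ℝ (JPEP.design (X n) Sl).col)
    (hXk : ∀ᶠ n in atTop, LinearIndependent ℝ (JPEP.design (X n) Sk).col)
    -- the ratios of residual sums of squares stay away from zero
    (ε : ℝ) (hε : 0 < ε)
    (hRl : ∀ᶠ n in atTop, ε ≤ JPEP.rss (X n) (y n) Sl / JPEP.rss (X n) (y n) S₀)
    (hRk : ∀ᶠ n in atTop, ε ≤ JPEP.rss (X n) (y n) Sk / JPEP.rss (X n) (y n) S₀) :
    -- the Bayes factor is well defined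
    (∀ᶠ n in atTop,
      (0 < JPEP.jpepMarginal (X n) (y n) c S₀ Sl ∧ JPEP.jpepMarginal (X n) (y n) c S₀ Sl < ⊤) ∧
      (0 < JPEP.jpepMarginal (X n) (y n) c S₀ Sk ∧ JPEP.jpepMarginal (X n) (y n) c S₀ Sk < ⊤)) ∧
    -- the approximation, with bounded error
    ((fun n : ℕ => -2 * Real.log (JPEP.jpepBF (X n) (y n) c S₀ Sl Sk)
        - (n * Real.log (JPEP.rss (X n) (y n) Sl / JPEP.rss (X n) (y n) Sk)
            + ((Sl.card : ℝ) - (Sk.card : ℝ)) * Real.log n))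
      =O[atTop] (fun _ : ℕ => (1 : ℝ))) ∧
    -- its right-hand side is the difference of the BIC values
    (∀ᶠ n : ℕ in atTop,
      n * Real.log (JPEP.rss (X n) (y n) Sl / JPEP.rss (X n) (y n) Sk)
          + ((Sl.card : ℝ) - (Sk.card : ℝ)) * Real.log n
        = JPEP.bic (X n) (y n) Sl - JPEP.bic (X n) (y n) Sk) ∧
    -- hence asymptotic equivalence whenever the BIC difference diverges
    (Tendsto (fun n : ℕ => |JPEP.bic (X n) (y n) Sl - JPEP.bic (X n) (y n) Sk|) atTop atTop →
      (fun n : ℕ => -2 * Real.log (JPEP.jpepBF (X n) (y n) c S₀ Sl Sk))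
        ~[atTop] (fun n : ℕ => JPEP.bic (X n) (y n) Sl - JPEP.bic (X n) (y n) Sk)) := by
  have hnl := eventually_ge_atTop (Sl.card + 3)
  have hnk := eventually_ge_atTop (Sk.card + 3)
  have hbig : (fun n : ℕ => -2 * Real.log (JPEP.jpepBF (X n) (y n) c S₀ Sl Sk)
        - (n * Real.log (JPEP.rss (X n) (y n) Sl / JPEP.rss (X n) (y n) Sk)
            + ((Sl.card : ℝ) - (Sk.card : ℝ)) * Real.log n))
      =O[atTop] (fun _ : ℕ => (1 : ℝ)) := by
    refine IsBigO.of_bound (2 * (3 * Sl.card + 1 / ε) + 2 * (3 * Sk.card + 1 / ε)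
      + |(Sl.card : ℝ) - Sk.card| + S₀.card * |Real.log ε|) ?_
    filter_upwards [hXl, hXk, hRl, hRk, hnl, hnk] with n xl xk rl rk nl nk
    rw [norm_one, mul_one, Real.norm_eq_abs]
    exact JPEP.abs_log_jpepBF_sub_le hc hl.subset hk.subset xl xk nl nk hε rl rk
  have hbic : ∀ᶠ n : ℕ in atTop,
      n * Real.log (JPEP.rss (X n) (y n) Sl / JPEP.rss (X n) (y n) Sk)
          + ((Sl.card : ℝ) - (Sk.card : ℝ)) * Real.log n
        = JPEP.bic (X n) (y n) Sl - JPEP.bic (X n) (y n) Sk := by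
    filter_upwards [hXl, hXk, hRl, hRk, hnl, hnk] with n xl xk rl rk nl nk
    exact JPEP.bic_sub_bic (by omega) xl xk
      (JPEP.jpepMarginal_bounds hc hl.subset xl nl hε rl).1
      (JPEP.jpepMarginal_bounds hc hk.subset xk nk hε rk).1
  refine ⟨?_, hbig, hbic, fun hdiv => ?_⟩
  · filter_upwards [hXl, hXk, hRl, hRk, hnl, hnk] with n xl xk rl rk nl nk
    obtain ⟨pl, tl, -⟩ := JPEP.jpepMarginal_pos_lt_top_and_log hc hl.subset xl nl hε rl
    obtain ⟨pk, tk, -⟩ := JPEP.jpepMarginal_pos_lt_top_and_log hc hk.subset xk nk hε rk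
    exact ⟨⟨pl, tl⟩, pk, tk⟩
  · refine JPEP.isEquivalent_of_sub_isBigO_one (hbig.congr' ?_ EventuallyEq.rfl) hdiv
    filter_upwards [hbic] with n hn
    rw [hn]
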